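/- **Theorem 1 (Regret of the NPAC-T policy).** *Model.* In each period $t=1,2,\dots$ a seller runs a second-price auction with $N\ge 2$ truthful buyers. The context $x_t\in\mathbb R^d$ ($d\ge 1$) is drawn from a distribution $\mathcal D$ with $\|x_t\|_\infty\le x_{\max}$ and positive definite covariance matrix, with smallest eigenvalue $\lambda_0^2>0$. Buyer $i$ values the item at, and bids, $v_{i,t}=\langle\beta,x_t\rangle+\epsilon_{i,t}\in[0,v_{\max}]$. The noises $\epsilon_{i,t}$ have mean zero and distribution $F$ with a density $f$ that vanishes outside $[-\epsilon_{\max},\epsilon_{\max}]$ and on this interval is bounded and bounded below by a positive constant; $c_f=\sup_{[-\epsilon_{\max},\epsilon_{\max}]}f$. All contexts and noises are independent; $\beta$, $F$, $\mathcal D$ are unknown to the seller, $v_{\max}$ is known. Let $v_t^+$ and $v_t^-$ be the highest and second-highest valuations. With reserve $r_t$, buyer $i$ pays $\max\{v_t^-,r_t\}\,\mathbb I\{v_{i,t}\ge\max\{v_t^+,r_t\}\}$, and $\mathsf{rev}_t(r_t)$ is the expected sum of payments given $x_t$ and $r_t$. *Benchmark and regret.* Put $F^+=F^N$, $F^-=NF^{N-1}-(N-1)F^N$,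 and, for $G^-,G^+:\mathbb R\to\mathbb R$ and $s,y\in\mathbb R$, $\rho(y;s,G^-,G^+)=\int_0^y G^-(z-s)\,dz-y\,G^+(y-s)$. The benchmark knows $\beta$ and $F$ and uses $r^\star(x)\in\arg\max_{y\ge 0}\rho(y;\langle\beta,x\rangle,F^-,F^+)$; its expected revenue is $\mathrm{REV}^\star_t=\int z\,dF^-(z)+\langle\beta,x_t\rangle+\rho(r^\star(x_t);\langle\beta,x_t\rangle,F^-,F^+)$. The regret is $\mathsf{Regret}(T)=\sum_{t=1}^T\mathbb E[\mathrm{REV}^\star_t-\mathsf{rev}_t(r_t)]$. *Policy.* Let $\hat\beta_1=0$, $\hat F_1^\pm=0$, and for $t\ge 1$, with $\bar v_\tau=\frac1N\sum_i v_{i,\tau}$ and $\dagger$ the Moore–Penrose inverse, $$\hat\beta_{t+1}=\Big(\sum_{\tau\le t}x_\tau x_\tau^\top\Big)^{\dagger}\sum_{\tau\le t}x_\tau\bar v_\tau,\qquad \hat F^{\pm}_{t+1}(z)=\frac1t\sum_{\tau\le t}\mathbb I\{v^\pm_\tau-\langle\hat\beta_{t+1},x_\tau\rangle\le z\}.$$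 In period $t$ the NPAC-T policy sets a reserve $r_t\in[0,v_{\max}]$ at which $\rho(\,\cdot\,;\langle\hat\beta_t,x_t\rangle,\hat F^-_t,\hat F^+_t)$ attains its supremum over $[0,v_{\max}]$, as a value or as a limit of values at points of $[0,v_{\max}]$ tending to $r_t$ (the function has downward jumps, so an exact maximizer need not exist); $r_t$ is a measurable function of $x_t$ and of the past contexts and bids. *Claim.* There is a constant $C>0$, depending only on $x_{\max},\epsilon_{\max},v_{\max},\lambda_0$, such that for all $d\ge1$, $N\ge 2$, all $\beta,F,\mathcal D$ as above, every choice of maximizers in the benchmark and in the policy, and all $T\ge 2$, the regret is well defined and $$\mathsf{Regret}(T)\le C\,c_f\sqrt{d\,N^3\,T\log T}.$$ -/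

import Mathlib

open MeasureTheory ProbabilityTheory Set Filter Topology

noncomputable section

namespace NPAC

/-! ### Order statistics of the bids and the second-price auction -/

/-- The highest entry of a vector of bids. -/
def highest {N : ℕ} (b : Fin N → ℝ) : ℝ := ⨆ i, b i

/-- The second-highest entry of a vector of `N ≥ 2` bids, counted with multiplicity: removing
one entry and taking the maximum of the others gives the least value when the removed entry
is a highest one. -/
def secondHighest {N : ℕ} (b : Fin N → ℝ) : ℝ := ⨅ i, ⨆ j : {j : Fin N // j ≠ i}, b j

open scoped Classical in
/-- Payment of buyer `i` in the second-price auction with reserve `r` and bids `b`. -/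
def payment {N : ℕ} (r : ℝ) (b : Fin N → ℝ) (i : Fin N) : ℝ :=
  max (secondHighest b) r * (if max (highest b) r ≤ b i then 1 else 0)

/-! ### The model: noise, contexts, valuations -/

/-- The market noise distribution `F` with density `f`. -/
def noiseLaw (f : ℝ → ℝ) : Measure ℝ := volume.withDensity fun z => ENNReal.ofReal (f z)

/-- `f` is a probability density with mean zero, supported in `[-εmax, εmax]`, on which it is
bounded above, and bounded below by a positive constant. -/
structure IsNoiseDensity (εmax : ℝ) (f : ℝ → ℝ) : Prop where
  measurable : Measurable f
  eq_zero_of_notMem : ∀ z, z ∉ Icc (-εmax) εmax → f z = 0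
  bddAbove : BddAbove (f '' Icc (-εmax) εmax)
  inf_pos : ∃ m > 0, ∀ z ∈ Icc (-εmax) εmax, m ≤ f z
  lintegral_eq_one : ∫⁻ z, ENNReal.ofReal (f z) = 1
  mean_zero : ∫ z, z ∂(noiseLaw f) = 0

/-- `c_f`, the supremum of the density over `[-εmax, εmax]`. -/
def densitySup (εmax : ℝ) (f : ℝ → ℝ) : ℝ := sSup (f '' Icc (-εmax) εmax)

/-- Covariance matrix of a distribution on `ℝ^d`. -/
def covMatrix {d : ℕ} (D : Measure (Fin d → ℝ)) : Matrix (Fin d) (Fin d) ℝ :=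
  Matrix.of fun i j => covariance (fun x : Fin d → ℝ => x i) (fun x : Fin d → ℝ => x j) D

/-- `D` is a context distribution: a probability law on `{x : ‖x‖_∞ ≤ xmax}` with positive
definite covariance matrix, whose smallest eigenvalue is `lam0 ^ 2`. -/
structure IsContextLaw {d : ℕ} (xmax lam0 : ℝ) (D : Measure (Fin d → ℝ)) : Prop where
  isProbabilityMeasure : IsProbabilityMeasure D
  bounded : ∀ᵐ x ∂D, ∀ j, |x j| ≤ xmax
  cov_posDef : (covMatrix D).PosDef
  isLeast_eigenvalue : IsLeast (spectrum ℝ (covMatrix D)) (lam0 ^ 2)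

/-- Valuations `⟨β, x⟩ + ε_i` of the `N` buyers, given context `x` and noise vector `e`. -/
def valuation {d N : ℕ} (β x : Fin d → ℝ) (e : Fin N → ℝ) : Fin N → ℝ :=
  fun i => β ⬝ᵥ x + e i

/-- Valuations always lie in `[0, vmax]`. -/
def ValuationsBounded {d : ℕ} (vmax : ℝ) (β : Fin d → ℝ) (f : ℝ → ℝ)
    (D : Measure (Fin d → ℝ)) : Prop :=
  ∀ᵐ x ∂D, ∀ᵐ z ∂(noiseLaw f), 0 ≤ β ⬝ᵥ x + z ∧ β ⬝ᵥ x + z ≤ vmax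

/-- The seller's expected revenue in one period with truthful buyers, given the context `x`
and the reserve `r`: the expected sum of the payments, over `N` independent noises. -/
def revenue {d : ℕ} (N : ℕ) (β : Fin d → ℝ) (f : ℝ → ℝ) (x : Fin d → ℝ) (r : ℝ) : ℝ :=
  ∫ e : Fin N → ℝ, ∑ i, payment r (valuation β x e) i ∂(Measure.pi fun _ => noiseLaw f)

/-! ### The clairvoyant benchmark -/

/-- `u ↦ N u^(N-1) - (N-1) u^N` is nondecreasing on `[0, 1]`. -/
lemma orderStat_monotoneOn (N : ℕ) :
    MonotoneOn (fun u : ℝ => N * u ^ (N - 1) - ((N : ℝ) - 1) * u ^ N) (Icc 0 1) := by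
  rcases N with _ | _ | n
  · intro u _ v _ _; simp
  · intro u _ v _ _; simp
  have hd : ∀ w : ℝ, HasDerivAt (fun u : ℝ => ((n + 1 + 1 : ℕ) : ℝ) * u ^ (n + 1 + 1 - 1)
      - (((n + 1 + 1 : ℕ) : ℝ) - 1) * u ^ (n + 1 + 1))
      (((n + 1 + 1 : ℕ) : ℝ) * ((n + 1 : ℕ) * w ^ n)
      - (((n + 1 + 1 : ℕ) : ℝ) - 1) * ((n + 1 + 1 : ℕ) * w ^ (n + 1))) w := fun w =>
    ((hasDerivAt_pow (n + 1) w).const_mul _).sub ((hasDerivAt_pow (n + 1 + 1) w).const_mul _)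
  refine monotoneOn_of_deriv_nonneg (convex_Icc 0 1)
    (fun w _ => (hd w).continuousAt.continuousWithinAt)
    (fun w _ => (hd w).differentiableAt.differentiableWithinAt) ?_
  intro w hw
  rw [interior_Icc] at hw
  rw [(hd w).deriv]
  have h1 : 0 ≤ w ^ n * (1 - w) := mul_nonneg (pow_nonneg hw.1.le _) (by linarith [hw.2])
  have h2 : (0 : ℝ) ≤ ((n : ℝ) + 2) * (n + 1) := by positivity
  push_cast
  nlinarith [mul_nonneg h2 h1, pow_succ w n]

/-- `F⁺ = F ^ N`, the distribution function of the highest of `N` noises. -/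
def Fplus (N : ℕ) (f : ℝ → ℝ) (z : ℝ) : ℝ := cdf (noiseLaw f) z ^ N

/-- `F⁻ = N F^(N-1) - (N-1) F^N`, the distribution function of the second-highest of `N`
noises, as a Stieltjes function, so that one can integrate against `dF⁻`. -/
def Fminus (N : ℕ) (f : ℝ → ℝ) : StieltjesFunction ℝ where
  toFun z := N * cdf (noiseLaw f) z ^ (N - 1) - ((N : ℝ) - 1) * cdf (noiseLaw f) z ^ N
  mono' _ _ h := orderStat_monotoneOn N ⟨cdf_nonneg _ _, cdf_le_one _ _⟩
    ⟨cdf_nonneg _ _, cdf_le_one _ _⟩ (monotone_cdf _ h)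
  right_continuous' z := by
    have h := (cdf (noiseLaw f)).right_continuous z
    exact ((h.pow _).const_mul _).sub ((h.pow _).const_mul _)

/-- The part of the expected revenue that depends on the reserve `y`:
`∫_0^y G⁻(z - s) dz - y G⁺(y - s)`, for distribution functions `G⁻`, `G⁺` and a common
value `s`. -/
def objective (Gminus Gplus : ℝ → ℝ) (s y : ℝ) : ℝ :=
  (∫ z in (0 : ℝ)..y, Gminus (z - s)) - y * Gplus (y - s)

/-- `rstar` is a benchmark reserve: `rstar x` maximizes the objective built from the true
`β`, `F⁻`, `F⁺` over all `y ≥ 0`. -/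
def IsBenchmark {d : ℕ} (N : ℕ) (β : Fin d → ℝ) (f : ℝ → ℝ) (rstar : (Fin d → ℝ) → ℝ) : Prop :=
  ∀ x, rstar x ∈ Ici (0 : ℝ) ∧
    IsMaxOn (objective (Fminus N f) (Fplus N f) (β ⬝ᵥ x)) (Ici 0) (rstar x)

/-- `REV*`, the benchmark's expected revenue in context `x`. -/
def benchmarkRevenue {d : ℕ} (N : ℕ) (β : Fin d → ℝ) (f : ℝ → ℝ) (rstar : (Fin d → ℝ) → ℝ)
    (x : Fin d → ℝ) : ℝ :=
  (∫ z, z ∂(Fminus N f).measure) + β ⬝ᵥ x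
    + objective (Fminus N f) (Fplus N f) (β ⬝ᵥ x) (rstar x)

/-! ### Pricing policies and regret -/

/-- The seller's record of `t` past periods: context vector and vector of bids of each. -/
abbrev History (d N t : ℕ) : Type := Fin t → (Fin d → ℝ) × (Fin N → ℝ)

/-- A pricing policy: after `t` past periods, a reserve price as a function of the history and
of the current context. -/
abbrev Policy (d N : ℕ) : Type := (t : ℕ) → History d N t → (Fin d → ℝ) → ℝ

/-- A policy whose reserve prices are measurable functions of history and context. -/
def Policy.IsMeasurable {d N : ℕ} (π : Policy d N) : Prop :=
  ∀ t, Measurable fun p : History d N t × (Fin d → ℝ) => π t p.1 p.2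

/-- Joint law of contexts and noises of `t` past periods and of the current context: all
contexts are drawn from `D` and all noises from `F`, independently. -/
def periodLaw {d : ℕ} (N : ℕ) (f : ℝ → ℝ) (D : Measure (Fin d → ℝ)) (t : ℕ) :
    Measure (History d N t × (Fin d → ℝ)) :=
  (Measure.pi fun _ : Fin t => D.prod (Measure.pi fun _ : Fin N => noiseLaw f)).prod D

/-- What the seller has observed when the past contexts and noises are `h` and every buyer
bids the true valuation. -/
def truthfulHistory {d N t : ℕ} (β : Fin d → ℝ) (h : History d N t) : History d N t :=
  fun τ => ((h τ).1, valuation β (h τ).1 (h τ).2)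

/-- Revenue lost against the benchmark in the period that follows `t` past periods, given past
contexts and noises and the current context. -/
def revenueLoss {d N : ℕ} (β : Fin d → ℝ) (f : ℝ → ℝ) (rstar : (Fin d → ℝ) → ℝ)
    (π : Policy d N) (t : ℕ) (p : History d N t × (Fin d → ℝ)) : ℝ :=
  benchmarkRevenue N β f rstar p.2 - revenue N β f p.2 (π t (truthfulHistory β p.1) p.2)

/-- Cumulative expected regret over `T` periods, with truthful buyers. -/
def regret {d N : ℕ} (β : Fin d → ℝ) (f : ℝ → ℝ) (D : Measure (Fin d → ℝ))
    (rstar : (Fin d → ℝ) → ℝ) (π : Policy d N) (T : ℕ) : ℝ :=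
  ∑ t ∈ Finset.range T, ∫ p, revenueLoss β f rstar π t p ∂(periodLaw N f D t)

/-! ### The Moore–Penrose pseudo-inverse -/

/-- `B` is the Moore–Penrose inverse of the real square matrix `A`. -/
structure IsMoorePenrose {d : ℕ} (A B : Matrix (Fin d) (Fin d) ℝ) : Prop where
  mul_mul_left : A * B * A = A
  mul_mul_right : B * A * B = B
  symm_left : (A * B).IsSymm
  symm_right : (B * A).IsSymm

/-- Symmetric matrices, the only ones whose pseudo-inverse is used here, have one. -/
lemma exists_isMoorePenrose {d : ℕ} {A : Matrix (Fin d) (Fin d) ℝ} (hA : A.IsHermitian) :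
    ∃ B, IsMoorePenrose A B := by
  set U : Matrix (Fin d) (Fin d) ℝ :=
    (hA.eigenvectorUnitary : Matrix (Fin d) (Fin d) ℝ) with hU
  set l := hA.eigenvalues
  have hUU : star U * U = 1 := Unitary.coe_star_mul_self _
  have hsp : A = U * Matrix.diagonal l * star U := by
    conv_lhs => rw [hA.spectral_theorem]
    rw [Unitary.conjStarAlgAut_apply]
    rfl
  have hmul : ∀ a b : Fin d → ℝ, (U * Matrix.diagonal a * star U)
      * (U * Matrix.diagonal b * star U) = U * Matrix.diagonal (fun i => a i * b i) * star U := by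
    intro a b
    calc _ = U * Matrix.diagonal a * (star U * U) * Matrix.diagonal b * star U := by
            simp only [Matrix.mul_assoc]
      _ = _ := by rw [hUU, Matrix.mul_one, Matrix.mul_assoc U, Matrix.diagonal_mul_diagonal]
  have hsymm : ∀ a : Fin d → ℝ, (U * Matrix.diagonal a * star U).IsSymm := by
    intro a
    have hs : star U = U.transpose := by
      rw [Matrix.star_eq_conjTranspose, Matrix.conjTranspose_eq_transpose_of_trivial]
    rw [hs]
    simp [Matrix.IsSymm, Matrix.transpose_mul, Matrix.mul_assoc]
  refine ⟨U * Matrix.diagonal (fun i => (l i)⁻¹) * star U, ?_, ?_, ?_, ?_⟩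
  · rw [hsp, hmul, hmul]; congr 3; funext i; exact mul_inv_mul_cancel (l i)
  · rw [hsp, hmul, hmul]; congr 3; funext i
    by_cases h : l i = 0 <;> simp [h]
  · rw [hsp, hmul]; exact hsymm _
  · rw [hsp, hmul]; exact hsymm _

/-- The Moore–Penrose inverse is unique. -/
lemma IsMoorePenrose.unique {d : ℕ} {A B C : Matrix (Fin d) (Fin d) ℝ}
    (hB : IsMoorePenrose A B) (hC : IsMoorePenrose A C) : B = C := by
  have h1 : A * B = A * C := by
    calc A * B = (A * B).transpose := hB.symm_left.symm
      _ = ((A * C) * (A * B)).transpose := by rw [← Matrix.mul_assoc, hC.mul_mul_left]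
      _ = (A * B) * (A * C) := by rw [Matrix.transpose_mul, hB.symm_left.eq, hC.symm_left.eq]
      _ = A * C := by rw [← Matrix.mul_assoc, hB.mul_mul_left]
  have h2 : B * A = C * A := by
    calc B * A = (B * A).transpose := hB.symm_right.symm
      _ = ((B * A) * (C * A)).transpose := by
          rw [Matrix.mul_assoc B, ← Matrix.mul_assoc A, hC.mul_mul_left]
      _ = (C * A) * (B * A) := by rw [Matrix.transpose_mul, hB.symm_right.eq, hC.symm_right.eq]
      _ = C * A := by rw [Matrix.mul_assoc C, ← Matrix.mul_assoc A, hB.mul_mul_left]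
  calc B = B * A * B := hB.mul_mul_right.symm
    _ = C * A * C := by rw [Matrix.mul_assoc, h1, ← Matrix.mul_assoc, h2]
    _ = C := hC.mul_mul_right

open scoped Classical in
/-- The pseudo-inverse `A†`. -/
def pinv {d : ℕ} (A : Matrix (Fin d) (Fin d) ℝ) : Matrix (Fin d) (Fin d) ℝ :=
  if h : ∃ B, IsMoorePenrose A B then h.choose else 0

/-! ### The NPAC-T policy -/

/-- The OLS estimate of `β` after `t` periods:
`(∑ x_τ x_τᵀ)† (∑ x_τ v̄_τ)`, with `v̄_τ` the average bid of period `τ`. -/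
def betaHat {d N t : ℕ} (h : History d N t) : Fin d → ℝ :=
  (pinv (∑ τ, Matrix.vecMulVec (h τ).1 (h τ).1)).mulVec
    (∑ τ, ((1 / (N : ℝ)) * ∑ i, (h τ).2 i) • (h τ).1)

open scoped Classical in
/-- Empirical distribution function of the highest residuals (zero when `t = 0`). -/
def FhatPlus {d N t : ℕ} (h : History d N t) (z : ℝ) : ℝ :=
  (1 / (t : ℝ)) * ∑ τ, if highest (h τ).2 - betaHat h ⬝ᵥ (h τ).1 ≤ z then 1 else 0

open scoped Classical in
/-- Empirical distribution function of the second-highest residuals (zero when `t = 0`). -/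
def FhatMinus {d N t : ℕ} (h : History d N t) (z : ℝ) : ℝ :=
  (1 / (t : ℝ)) * ∑ τ, if secondHighest (h τ).2 - betaHat h ⬝ᵥ (h τ).1 ≤ z then 1 else 0

/-- `r ∈ S` attains the supremum of `g` over `S`, either as a value of `g` or as a limit of
values of `g` along points of `S` that tend to `r`. Every maximizer of `g` on `S` is such a
point. The limits are needed because the estimated objective jumps downwards at the jumps of a
right-continuous step function and then need not have a maximizer. -/
def IsArgmaxOrLimit (g : ℝ → ℝ) (S : Set ℝ) (r : ℝ) : Prop :=
  r ∈ S ∧ ∀ y ∈ S, ∀ δ > 0, ∃ᶠ y' in 𝓝[S] r, g y < g y' + δ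

/-- `π` is an NPAC-T policy: in every period its reserve maximizes over `[0, vmax]` the
objective in which `β`, `F⁻`, `F⁺` are replaced by their current estimates. Ties are broken in
any measurable way. -/
structure IsNPACT {d N : ℕ} (vmax : ℝ) (π : Policy d N) : Prop where
  measurable : π.IsMeasurable
  argmax : ∀ (t : ℕ) (h : History d N t) (x : Fin d → ℝ),
    IsArgmaxOrLimit (objective (FhatMinus h) (FhatPlus h) (betaHat h ⬝ᵥ x)) (Icc 0 vmax)
      (π t h x)

end NPAC

end

namespace NPAC

/-! ### Order statistics and payments -/

section OrderStatistics

variable {N : ℕ}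

/-! In expectation, the revenue of a reserve `y` in context `x` is a term independent of `y` plus
the objective built from `F⁻` and `F⁺` (`revenue_eq`). The loss of a period is therefore the gap in
the true objective between the benchmark reserve and the policy's reserve. The policy's reserve
maximizes, possibly as a limit, an estimated objective, so on `[0, vmax]` this gap is at most twice
the uniform distance of the two objectives, and that distance is at most `vmax` times the sum of the
uniform errors of the two estimated distribution functions (`revenueLoss_le`).

The difficulty is that the residuals use an estimate of `β` computed from the same data. An
empirical distribution function of residuals is, at each point, the empirical frequency of a
half-space in the pairs (context, order statistic of the noises), with slope `betaHat - β`. A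
deviation bound uniform over all half-spaces thus removes the dependence. Half-spaces shatter at
most `d + 2` points, so Sauer-Shelah, symmetrization and Massart's lemma give an expected deviation
of order `√(d log n / n)` (`exists_uniform_deviation`). The population frequency differs from the
true distribution function by a Lipschitz constant `N * c_f` times the prediction errors at the
current and at a fresh context (`exists_estimation_error`).

The prediction error is bounded on average over contexts, and not through the distance of `betaHat`
to `β`. The leverages of `n + 1` exchangeable contexts sum to the trace of a projection, so a fresh
context has expected leverage at most `d / (n + 1)` (`integral_leverage_le`). Where the leverage is
small, least squares is unbiased with variance of the order of the leverage; where it is large, the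
error truncated at one is already below the square root of twice the leverage
(`lintegral_min_predError_le`). No invertibility of the Gram matrix is needed.

A period after `n` observations thus loses at most a constant times `N * c_f * √(d log T / (n +
1))`. Summation over the horizon contributes `√T`, with `N ^ 2 ≤ N ^ 3` under the root. -/

lemma highest_le_iff (hN : 2 ≤ N) (b : Fin N → ℝ) (z : ℝ) : highest b ≤ z ↔ ∀ i, b i ≤ z := by
  have : Nonempty (Fin N) := ⟨⟨0, by omega⟩⟩
  exact ciSup_le_iff (Finite.bddAbove_range b)

lemma le_highest (hN : 2 ≤ N) (b : Fin N → ℝ) (i : Fin N) : b i ≤ highest b :=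
  (highest_le_iff hN b _).1 le_rfl i

lemma exists_eq_highest (hN : 2 ≤ N) (b : Fin N → ℝ) : ∃ i, highest b = b i := by
  have : Nonempty (Fin N) := ⟨⟨0, by omega⟩⟩
  obtain ⟨i, hi⟩ := exists_eq_ciSup_of_finite (f := b)
  exact ⟨i, hi.symm⟩

lemma exists_ne_fin (hN : 2 ≤ N) (i : Fin N) : ∃ j : Fin N, j ≠ i := by
  have : Nontrivial (Fin N) := Fin.nontrivial_iff_two_le.2 hN
  exact exists_ne i

/-- Over finitely many bidders the infimum is attained, and the removed bidder is the one allowed to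
exceed `z`. -/
lemma secondHighest_le_iff (hN : 2 ≤ N) (b : Fin N → ℝ) (z : ℝ) :
    secondHighest b ≤ z ↔ ∃ i, ∀ j, j ≠ i → b j ≤ z := by
  have : Nonempty (Fin N) := ⟨⟨0, by omega⟩⟩
  have : ∀ i : Fin N, Nonempty {j : Fin N // j ≠ i} := fun i =>
    let ⟨j, hj⟩ := exists_ne_fin hN i; ⟨⟨j, hj⟩⟩
  have key : ∀ i : Fin N, (⨆ j : {j : Fin N // j ≠ i}, b j) ≤ z ↔ ∀ j, j ≠ i → b j ≤ z := by
    intro i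
    rw [ciSup_le_iff (Finite.bddAbove_range _)]
    exact ⟨fun h j hj => h ⟨j, hj⟩, fun h j => h j.1 j.2⟩
  constructor
  · intro h
    obtain ⟨i, hi⟩ := exists_eq_ciInf_of_finite
      (f := fun i => ⨆ j : {j : Fin N // j ≠ i}, b j)
    exact ⟨i, (key i).1 (hi.le.trans h)⟩
  · rintro ⟨i, hi⟩
    exact (ciInf_le (Finite.bddBelow_range _) i).trans ((key i).2 hi)

lemma exists_eq_secondHighest (hN : 2 ≤ N) (b : Fin N → ℝ) : ∃ i, secondHighest b = b i := by
  have : Nonempty (Fin N) := ⟨⟨0, by omega⟩⟩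
  have : ∀ i : Fin N, Nonempty {j : Fin N // j ≠ i} := fun i =>
    let ⟨j, hj⟩ := exists_ne_fin hN i; ⟨⟨j, hj⟩⟩
  obtain ⟨i, hi⟩ := exists_eq_ciInf_of_finite
    (f := fun i => ⨆ j : {j : Fin N // j ≠ i}, b j)
  obtain ⟨j, hj⟩ := exists_eq_ciSup_of_finite (f := fun j : {j : Fin N // j ≠ i} => b j)
  exact ⟨j.1, hi.symm.trans hj.symm⟩

lemma secondHighest_le_highest (hN : 2 ≤ N) (b : Fin N → ℝ) : secondHighest b ≤ highest b :=
  (secondHighest_le_iff hN b _).2 ⟨⟨0, by omega⟩, fun j _ => le_highest hN b j⟩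

lemma measurable_highest : Measurable (highest : (Fin N → ℝ) → ℝ) :=
  Measurable.iSup fun i => measurable_pi_apply i

lemma measurable_secondHighest : Measurable (secondHighest : (Fin N → ℝ) → ℝ) :=
  Measurable.iInf fun _ => Measurable.iSup fun j => measurable_pi_apply j.1

/-- A measurable statistic of a bid vector that always returns one of the bids and commutes with
common shifts: both order statistics of the auction are of this kind. -/
structure IsBidStatistic (g : (Fin N → ℝ) → ℝ) : Prop where
  measurable : Measurable g
  exists_eq : ∀ b, ∃ i, g b = b i
  shift : ∀ (s : ℝ) (b : Fin N → ℝ), g (fun i => s + b i) = s + g b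

lemma isBidStatistic_highest (hN : 2 ≤ N) : IsBidStatistic (highest : (Fin N → ℝ) → ℝ) where
  measurable := measurable_highest
  exists_eq := exists_eq_highest hN
  shift s b := by
    refine eq_of_forall_ge_iff fun c => ?_
    rw [highest_le_iff hN, ← le_sub_iff_add_le', highest_le_iff hN]
    simp only [le_sub_iff_add_le']

lemma isBidStatistic_secondHighest (hN : 2 ≤ N) :
    IsBidStatistic (secondHighest : (Fin N → ℝ) → ℝ) where
  measurable := measurable_secondHighest
  exists_eq := exists_eq_secondHighest hN
  shift s b := by
    refine eq_of_forall_ge_iff fun c => ?_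
    rw [secondHighest_le_iff hN, ← le_sub_iff_add_le', secondHighest_le_iff hN]
    simp only [le_sub_iff_add_le']

/-- With distinct bids, only the highest bidder pays, and only if the reserve is met. -/
lemma sum_payment (hN : 2 ≤ N) {b : Fin N → ℝ} (hb : Function.Injective b) (r : ℝ) :
    ∑ i, payment r b i = secondHighest b + max (r - secondHighest b) 0
      - (if highest b < r then r else 0) := by
  classical
  obtain ⟨k, hk⟩ := exists_eq_highest hN b
  have hsum : ∑ i, payment r b i = payment r b k := by
    refine Finset.sum_eq_single k (fun i _ hik => ?_) (by simp)
    have h1 : b i < highest b :=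
      lt_of_le_of_ne (le_highest hN b i) fun h => hik (hb (h.trans hk))
    have h2 : ¬ max (highest b) r ≤ b i := fun h => absurd ((le_max_left _ _).trans h) (not_le.2 h1)
    simp [payment, h2]
  have h12 := secondHighest_le_highest hN b
  rw [hsum, payment, ← hk]
  by_cases h : highest b < r
  · have h2 : ¬ max (highest b) r ≤ highest b := by simpa using h
    rw [if_neg h2, if_pos h, mul_zero, max_eq_left (by linarith)]
    ring
  · have h2 : max (highest b) r ≤ highest b := by simpa using h
    rw [if_pos h2, if_neg h]
    rcases le_total r (secondHighest b) with h3 | h3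
    · rw [max_eq_left h3, max_eq_right (by linarith)]; ring
    · rw [max_eq_right h3, max_eq_left (by linarith)]; ring

open scoped Classical in
/-- The event that at most one bid exceeds `z`, by inclusion and exclusion over the bidder that
may exceed it. -/
lemma ite_secondHighest_le (hN : 2 ≤ N) (b : Fin N → ℝ) (z : ℝ) :
    (if secondHighest b ≤ z then (1 : ℝ) else 0)
      = (∑ i, if ∀ j, j ≠ i → b j ≤ z then 1 else 0)
        - ((N : ℝ) - 1) * if ∀ j, b j ≤ z then 1 else 0 := by
  by_cases h : ∀ j, b j ≤ z
  · have h1 : ∀ i : Fin N, ∀ j, j ≠ i → b j ≤ z := fun _ j _ => h j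
    rw [if_pos ((secondHighest_le_iff hN b z).2 ⟨⟨0, by omega⟩, h1 _⟩)]
    simp [h]
  · rw [if_neg h, mul_zero, sub_zero]
    by_cases h2 : secondHighest b ≤ z
    · rw [if_pos h2]
      obtain ⟨k, hk⟩ := (secondHighest_le_iff hN b z).1 h2
      rw [Finset.sum_eq_single k, if_pos hk]
      · intro i _ hik
        refine if_neg fun hi => h fun j => ?_
        by_cases hj : j = i
        · exact hk j (hj ▸ hik)
        · exact hi j hj
      · simp
    · rw [if_neg h2]
      refine (Finset.sum_eq_zero fun i _ => if_neg fun hi => h2 ?_).symm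
      exact (secondHighest_le_iff hN b z).2 ⟨i, hi⟩

end OrderStatistics

end NPAC

namespace NPAC

/-! ### The noise distribution -/

section NoiseLaw

variable {εmax : ℝ} {f : ℝ → ℝ}

lemma IsNoiseDensity.isProbabilityMeasure_noiseLaw (hf : IsNoiseDensity εmax f) :
    IsProbabilityMeasure (noiseLaw f) :=
  ⟨by rw [noiseLaw, withDensity_apply _ MeasurableSet.univ, Measure.restrict_univ,
    hf.lintegral_eq_one]⟩

lemma IsNoiseDensity.densitySup_nonneg (hf : IsNoiseDensity εmax f) : 0 ≤ densitySup εmax f := by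
  obtain ⟨m, hm, h⟩ := hf.inf_pos
  refine Real.sSup_nonneg ?_
  rintro _ ⟨z, hz, rfl⟩
  exact hm.le.trans (h z hz)

lemma IsNoiseDensity.le_densitySup (hf : IsNoiseDensity εmax f) (z : ℝ) :
    f z ≤ densitySup εmax f := by
  by_cases hz : z ∈ Icc (-εmax) εmax
  · exact le_csSup hf.bddAbove (mem_image_of_mem f hz)
  · rw [hf.eq_zero_of_notMem z hz]; exact hf.densitySup_nonneg

lemma IsNoiseDensity.noiseLaw_le (hf : IsNoiseDensity εmax f) {s : Set ℝ} (hs : MeasurableSet s) :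
    noiseLaw f s ≤ ENNReal.ofReal (densitySup εmax f) * volume s := by
  rw [noiseLaw, withDensity_apply _ hs, ← setLIntegral_const]
  exact lintegral_mono fun z => ENNReal.ofReal_le_ofReal (hf.le_densitySup z)

lemma IsNoiseDensity.ae_mem_Icc (hf : IsNoiseDensity εmax f) :
    ∀ᵐ z ∂noiseLaw f, z ∈ Icc (-εmax) εmax := by
  change noiseLaw f (Icc (-εmax) εmax)ᶜ = 0
  rw [noiseLaw, withDensity_apply _ measurableSet_Icc.compl,
    setLIntegral_congr_fun (g := fun _ => 0) measurableSet_Icc.compl fun z hz => ?_]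
  · simp
  · simp only
    rw [hf.eq_zero_of_notMem z hz, ENNReal.ofReal_zero]

/-- A unit mass sits on an interval of length `2 * εmax`. This serves to absorb into the final bound
the terms that carry no factor `c_f`. -/
lemma IsNoiseDensity.one_le_densitySup (hf : IsNoiseDensity εmax f) :
    1 ≤ 2 * εmax * densitySup εmax f := by
  have := hf.isProbabilityMeasure_noiseLaw
  have h1 : noiseLaw f (Icc (-εmax) εmax) = 1 := (prob_compl_eq_zero_iff measurableSet_Icc).1
    hf.ae_mem_Icc
  have h2 := hf.noiseLaw_le (s := Icc (-εmax) εmax) measurableSet_Icc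
  rw [h1, Real.volume_Icc, ← ENNReal.ofReal_mul hf.densitySup_nonneg, ENNReal.one_le_ofReal] at h2
  linarith

lemma IsNoiseDensity.nullSingletonClass (hf : IsNoiseDensity εmax f) : NullSingletonClass (noiseLaw f) :=
  ⟨fun z => by simpa using hf.noiseLaw_le (measurableSet_singleton z)⟩

/-- The joint law of the noises of the buyers in one period. -/
noncomputable abbrev noiseVec (N : ℕ) (f : ℝ → ℝ) : Measure (Fin N → ℝ) := Measure.pi fun _ => noiseLaw f

/-- The distribution function of a statistic of the noises. -/
noncomputable def statCdf {N : ℕ} (f : ℝ → ℝ) (g : (Fin N → ℝ) → ℝ) (z : ℝ) : ℝ :=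
  (noiseVec N f).real {e | g e ≤ z}

variable {N : ℕ} {g : (Fin N → ℝ) → ℝ}

lemma ae_noiseVec [IsProbabilityMeasure (noiseLaw f)] {p : ℝ → Prop}
    (h : ∀ᵐ z ∂noiseLaw f, p z) : ∀ᵐ e ∂noiseVec N f, ∀ i, p (e i) :=
  ae_all_iff.2 fun i =>
    (measurePreserving_eval (fun _ : Fin N => noiseLaw f) i).quasiMeasurePreserving.ae h

lemma statCdf_nonneg (z : ℝ) : 0 ≤ statCdf f g z := measureReal_nonneg

lemma statCdf_le_one [IsProbabilityMeasure (noiseLaw f)] (z : ℝ) : statCdf f g z ≤ 1 :=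
  measureReal_le_one

lemma statCdf_mono [IsProbabilityMeasure (noiseLaw f)] : Monotone (statCdf f g) :=
  fun _ _ h => measureReal_mono fun _ he => le_trans he h

/-- A union bound over the buyers shows that the law of a bid statistic has density at most
`N * c_f`. -/
lemma abs_statCdf_sub_le (hf : IsNoiseDensity εmax f) (hg : IsBidStatistic g) (a b : ℝ) :
    |statCdf f g a - statCdf f g b| ≤ N * densitySup εmax f * |a - b| := by
  have := hf.isProbabilityMeasure_noiseLaw
  wlog hab : a ≤ b generalizing a b
  · rw [abs_sub_comm, abs_sub_comm a]
    exact this b a (le_of_not_ge hab)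
  rw [abs_sub_comm, abs_of_nonneg (sub_nonneg.2 (statCdf_mono hab)), abs_sub_comm,
    abs_of_nonneg (sub_nonneg.2 hab), sub_le_iff_le_add, add_comm]
  -- The statistic always equals one of the bids, so its lying in `(a, b]` forces some coordinate
  -- into `(a, b]`.
  have hsub : {e : Fin N → ℝ | g e ≤ b} ⊆
      {e | g e ≤ a} ∪ ⋃ i, (fun e : Fin N → ℝ => e i) ⁻¹' Ioc a b := by
    intro e he
    by_cases h : g e ≤ a
    · exact Or.inl h
    · obtain ⟨i, hi⟩ := hg.exists_eq e
      refine Or.inr (mem_iUnion.2 ⟨i, ?_⟩)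
      rw [mem_preimage, ← hi]
      exact ⟨not_le.1 h, he⟩
  have hone : ∀ i : Fin N, (noiseVec N f).real ((fun e : Fin N → ℝ => e i) ⁻¹' Ioc a b)
      ≤ densitySup εmax f * (b - a) := by
    intro i
    rw [(measurePreserving_eval (fun _ : Fin N => noiseLaw f) i).measureReal_preimage
      measurableSet_Ioc.nullMeasurableSet]
    refine ENNReal.toReal_le_of_le_ofReal
      (mul_nonneg hf.densitySup_nonneg (sub_nonneg.2 hab)) ?_
    rw [ENNReal.ofReal_mul hf.densitySup_nonneg, ← Real.volume_Ioc]
    exact hf.noiseLaw_le measurableSet_Ioc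
  calc statCdf f g b ≤ (noiseVec N f).real
        ({e | g e ≤ a} ∪ ⋃ i, (fun e : Fin N → ℝ => e i) ⁻¹' Ioc a b) := measureReal_mono hsub
    _ ≤ statCdf f g a + (noiseVec N f).real (⋃ i, (fun e : Fin N → ℝ => e i) ⁻¹' Ioc a b) :=
        measureReal_union_le _ _
    _ ≤ statCdf f g a + ∑ i : Fin N, (noiseVec N f).real ((fun e : Fin N → ℝ => e i) ⁻¹' Ioc a b) := by
        gcongr; exact measureReal_iUnion_fintype_le _
    _ ≤ statCdf f g a + ∑ _i : Fin N, densitySup εmax f * (b - a) := by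
        gcongr with i; exact hone i
    _ = _ := by simp [mul_assoc]

lemma continuous_statCdf (hf : IsNoiseDensity εmax f) (hg : IsBidStatistic g) :
    Continuous (statCdf f g) :=
  (LipschitzWith.of_dist_le_mul (K := Real.toNNReal (N * densitySup εmax f)) fun a b => by
    rw [Real.coe_toNNReal _ (mul_nonneg (Nat.cast_nonneg _) hf.densitySup_nonneg)]
    exact abs_statCdf_sub_le hf hg a b).continuous

lemma Fplus_eq_statCdf (hf : IsNoiseDensity εmax f) (hN : 2 ≤ N) :
    Fplus N f = statCdf f (highest : (Fin N → ℝ) → ℝ) := by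
  have := hf.isProbabilityMeasure_noiseLaw
  funext z
  have h : {e : Fin N → ℝ | highest e ≤ z} = univ.pi fun _ => Iic z := by
    ext e; simp only [mem_ofPred_eq, highest_le_iff hN, mem_univ_pi, mem_Iic]
  rw [Fplus, statCdf, h, measureReal_def, Measure.pi_pi, cdf_eq_real]
  simp [measureReal_def]

/-- Integrate the inclusion-exclusion identity `ite_secondHighest_le`: leaving buyer `i`
unconstrained gives a box of probability `F ^ (N - 1)`, and constraining all buyers gives one of
probability `F ^ N`. -/
lemma Fminus_eq_statCdf (hf : IsNoiseDensity εmax f) (hN : 2 ≤ N) :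
    ⇑(Fminus N f) = statCdf f (secondHighest : (Fin N → ℝ) → ℝ) := by
  classical
  have := hf.isProbabilityMeasure_noiseLaw
  funext z
  have hB : ∀ i : Fin N, {e : Fin N → ℝ | ∀ j, j ≠ i → e j ≤ z}
      = univ.pi (Function.update (fun _ => Iic z) i univ) := by
    intro i
    ext e
    simp only [mem_ofPred_eq, mem_univ_pi]
    refine forall_congr' fun j => ?_
    by_cases hj : j = i
    · subst hj; simp
    · simp [hj]
  have hA : {e : Fin N → ℝ | ∀ j, e j ≤ z} = univ.pi fun _ => Iic z := by
    ext e; simp only [mem_ofPred_eq, mem_univ_pi, mem_Iic]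
  have mB : ∀ i : Fin N, MeasurableSet {e : Fin N → ℝ | ∀ j, j ≠ i → e j ≤ z} := by
    intro i
    rw [hB]
    refine MeasurableSet.univ_pi fun j => ?_
    by_cases hj : j = i
    · subst hj; simp
    · simp [hj]
  have mA : MeasurableSet {e : Fin N → ℝ | ∀ j, e j ≤ z} := by
    rw [hA]; exact MeasurableSet.univ_pi fun _ => measurableSet_Iic
  have vB : ∀ i : Fin N, (noiseVec N f).real {e : Fin N → ℝ | ∀ j, j ≠ i → e j ≤ z}
      = cdf (noiseLaw f) z ^ (N - 1) := by
    intro i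
    have hprod : ∀ j, noiseLaw f (Function.update (fun _ => Iic z) i univ j)
        = Function.update (fun _ => noiseLaw f (Iic z)) i 1 j := by
      intro j
      by_cases hj : j = i
      · subst hj; simp
      · simp [hj]
    rw [hB, measureReal_def, Measure.pi_pi, Finset.prod_congr rfl fun j _ => hprod j,
      Finset.prod_update_of_mem (Finset.mem_univ i), cdf_eq_real]
    simp [measureReal_def, Finset.card_sdiff]
  have vA : (noiseVec N f).real {e : Fin N → ℝ | ∀ j, e j ≤ z} = cdf (noiseLaw f) z ^ N := by
    rw [hA, measureReal_def, Measure.pi_pi, cdf_eq_real]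
    simp [measureReal_def]
  have mS : MeasurableSet {e : Fin N → ℝ | secondHighest e ≤ z} :=
    measurable_secondHighest measurableSet_Iic
  have iB : ∀ i : Fin N, Integrable (({e : Fin N → ℝ | ∀ j, j ≠ i → e j ≤ z}).indicator
      (1 : (Fin N → ℝ) → ℝ)) (noiseVec N f) := fun i =>
    (integrable_const (1 : ℝ)).indicator (mB i)
  have iA : Integrable (({e : Fin N → ℝ | ∀ j, e j ≤ z}).indicator
      (1 : (Fin N → ℝ) → ℝ)) (noiseVec N f) := (integrable_const (1 : ℝ)).indicator mA
  have key : ({e : Fin N → ℝ | secondHighest e ≤ z}).indicator (1 : (Fin N → ℝ) → ℝ)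
      = fun e => (∑ i, ({e : Fin N → ℝ | ∀ j, j ≠ i → e j ≤ z}).indicator
          (1 : (Fin N → ℝ) → ℝ) e)
        - ((N : ℝ) - 1) * ({e : Fin N → ℝ | ∀ j, e j ≤ z}).indicator
          (1 : (Fin N → ℝ) → ℝ) e := by
    funext e
    simp only [indicator_apply, mem_ofPred_eq, Pi.one_apply]
    convert ite_secondHighest_le hN e z
  rw [statCdf, ← integral_indicator_one mS, key, integral_sub (integrable_finsetSum _ fun i _ => iB i)
    (iA.const_mul _), integral_finsetSum _ fun i _ => iB i, integral_const_mul,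
    integral_indicator_one mA, vA]
  simp only [integral_indicator_one (mB _), vB]
  simp [Fminus]

/-- A probability measure on the line is determined by its distribution function. Hence `∫ z dF⁻` in
the benchmark is the expected second-highest noise. -/
lemma map_secondHighest (hf : IsNoiseDensity εmax f) (hN : 2 ≤ N) :
    (Fminus N f).measure = (noiseVec N f).map secondHighest := by
  have := hf.isProbabilityMeasure_noiseLaw
  have hp : IsProbabilityMeasure ((noiseVec N f).map secondHighest) :=
    Measure.isProbabilityMeasure_map measurable_secondHighest.aemeasurable
  have h : cdf ((noiseVec N f).map secondHighest) = Fminus N f := by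
    ext z
    rw [cdf_eq_real, Fminus_eq_statCdf hf hN,
      map_measureReal_apply measurable_secondHighest measurableSet_Iic]
    rfl
  rw [← h, measure_cdf]

lemma integral_Fminus (hf : IsNoiseDensity εmax f) (hN : 2 ≤ N) :
    ∫ z, z ∂(Fminus N f).measure = ∫ e, secondHighest e ∂noiseVec N f := by
  rw [map_secondHighest hf hN, integral_map measurable_secondHighest.aemeasurable
    (f := fun z : ℝ => z) measurable_id.aestronglyMeasurable]

lemma integrable_statistic (hf : IsNoiseDensity εmax f) (hg : IsBidStatistic g) :
    Integrable g (noiseVec N f) := by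
  have := hf.isProbabilityMeasure_noiseLaw
  refine Integrable.of_bound hg.measurable.aestronglyMeasurable εmax ?_
  filter_upwards [ae_noiseVec hf.ae_mem_Icc] with e he
  obtain ⟨i, hi⟩ := hg.exists_eq e
  rw [hi, Real.norm_eq_abs, abs_le]
  exact ⟨(he i).1, (he i).2⟩

/-- Under a tie at the top `payment` would charge several buyers. Two coordinates are independent
with atomless laws, so the diagonal is null by Fubini. -/
lemma ae_injective (hf : IsNoiseDensity εmax f) :
    ∀ᵐ e ∂noiseVec N f, Function.Injective e := by
  have := hf.isProbabilityMeasure_noiseLaw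
  have := hf.nullSingletonClass
  have hpair : ∀ i j : Fin N, i ≠ j → ∀ᵐ e ∂noiseVec N f, e i ≠ e j := by
    intro i j hij
    have hind : IndepFun (fun e : Fin N → ℝ => e i) (fun e => e j) (noiseVec N f) :=
      (iIndepFun_pi (μ := fun _ : Fin N => noiseLaw f) (X := fun _ => id)
        fun _ => aemeasurable_id).indepFun hij
    have hmap := (indepFun_iff_map_prod_eq_prod_map_map (measurable_pi_apply i).aemeasurable
      (measurable_pi_apply j).aemeasurable).1 hind
    rw [(measurePreserving_eval (fun _ : Fin N => noiseLaw f) i).map_eq,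
      (measurePreserving_eval (fun _ : Fin N => noiseLaw f) j).map_eq] at hmap
    have hm : MeasurableSet {p : ℝ × ℝ | p.1 = p.2} :=
      measurableSet_eq_fun measurable_fst measurable_snd
    have h0 : ((noiseLaw f).prod (noiseLaw f)) {p : ℝ × ℝ | p.1 = p.2} = 0 := by
      rw [Measure.measure_prod_null hm]
      refine Eventually.of_forall fun a => ?_
      have : Prod.mk a ⁻¹' {p : ℝ × ℝ | p.1 = p.2} = {a} := by
        ext b; simp [eq_comm]
      simp only [this, measure_singleton, Pi.zero_apply]
    rw [← hmap, Measure.map_apply (by fun_prop) hm] at h0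
    simpa [ae_iff] using h0
  have hall : ∀ᵐ e ∂noiseVec N f, ∀ i j : Fin N, i ≠ j → e i ≠ e j :=
    ae_all_iff.2 fun i => ae_all_iff.2 fun j => by
      by_cases hij : i = j
      · simp [hij]
      · filter_upwards [hpair i j hij] with e he _ using he
  filter_upwards [hall] with e he i j hij
  by_contra h
  exact he i j h hij

/-- The sale fails when the highest bid is strictly below the reserve, while `F⁺` counts weak
inequalities; without atoms the two agree. -/
lemma statCdf_lt (hf : IsNoiseDensity εmax f) (hg : IsBidStatistic g) (z : ℝ) :
    (noiseVec N f).real {e | g e < z} = statCdf f g z := by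
  have := hf.isProbabilityMeasure_noiseLaw
  have := hf.nullSingletonClass
  refine measureReal_congr ?_
  have hz : ∀ᵐ e ∂noiseVec N f, ∀ i, e i ≠ z :=
    ae_noiseVec (p := fun w => w ≠ z) (by simp [ae_iff])
  filter_upwards [hz] with e he
  obtain ⟨i, hi⟩ := hg.exists_eq e
  have h1 : g e ≠ z := hi ▸ he i
  exact propext ⟨le_of_lt, fun h => lt_of_le_of_ne h h1⟩

/-- The expected shortfall of a statistic of the valuations below a reserve. -/
lemma integral_shortfall (hf : IsNoiseDensity εmax f) (hg : IsBidStatistic g) {s r : ℝ}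
    (hs : ∀ᵐ z ∂noiseLaw f, 0 ≤ s + z) (hr : 0 ≤ r) :
    ∫ e, max (r - (s + g e)) 0 ∂noiseVec N f = ∫ z in (0 : ℝ)..r, statCdf f g (z - s) := by
  have := hf.isProbabilityMeasure_noiseLaw
  have hm : MeasurableSet {p : (Fin N → ℝ) × ℝ | s + g p.1 ≤ p.2} :=
    measurableSet_le ((hg.measurable.comp measurable_fst).const_add s) measurable_snd
  -- Layer cake: the shortfall is the length of the set of `z` in `(0, r]` that reach the valuation.
  -- Nonnegative valuations ensure that cutting at `0` loses at most an endpoint. Fubini then gives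
  -- the integral of the distribution function.
  have hpt : ∀ᵐ e ∂noiseVec N f, max (r - (s + g e)) 0
      = ∫ z in Ioc 0 r, {p : (Fin N → ℝ) × ℝ | s + g p.1 ≤ p.2}.indicator
        (1 : (Fin N → ℝ) × ℝ → ℝ) (e, z) := by
    filter_upwards [ae_noiseVec hs] with e he
    have h0 : 0 ≤ s + g e := by
      obtain ⟨i, hi⟩ := hg.exists_eq e
      rw [hi]; exact he i
    have h1 : (fun z => {p : (Fin N → ℝ) × ℝ | s + g p.1 ≤ p.2}.indicator
        (1 : (Fin N → ℝ) × ℝ → ℝ) (e, z)) = (Ici (s + g e)).indicator 1 := by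
      funext z; simp [indicator_apply]
    rw [h1, integral_indicator_one measurableSet_Ici, measureReal_restrict_apply measurableSet_Ici]
    have h2 : (Ici (s + g e) ∩ Ioc 0 r : Set ℝ) =ᵐ[volume] Icc (s + g e) r := by
      rcases h0.eq_or_lt with h | h
      · rw [← h]
        have : (Ici 0 ∩ Ioc 0 r : Set ℝ) = Ioc 0 r :=
          inter_eq_right.2 fun z hz => hz.1.le
        rw [this]; exact Ioc_ae_eq_Icc
      · refine Eventually.of_forall fun z => propext ⟨fun hz => ⟨hz.1, hz.2.2⟩,
          fun hz => ⟨hz.1, h.trans_le hz.1, hz.2⟩⟩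
    rw [measureReal_congr h2, Real.volume_real_Icc]
  rw [integral_congr_ae hpt, integral_integral_swap]
  · rw [intervalIntegral.integral_of_le hr]
    refine setIntegral_congr_fun measurableSet_Ioc fun z _ => ?_
    have h1 : (fun e => {p : (Fin N → ℝ) × ℝ | s + g p.1 ≤ p.2}.indicator
        (1 : (Fin N → ℝ) × ℝ → ℝ) (e, z)) = {e | g e ≤ z - s}.indicator 1 := by
      funext e; simp [indicator_apply, le_sub_iff_add_le']
    have h2 : MeasurableSet {e : Fin N → ℝ | g e ≤ z - s} := hg.measurable measurableSet_Iic
    rw [h1, integral_indicator_one h2]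
    rfl
  · exact (integrable_const (1 : ℝ)).indicator hm

variable {d : ℕ}

/-- The seller's expected revenue: the mean second-highest valuation plus the objective. -/
lemma revenue_eq (hf : IsNoiseDensity εmax f) (hN : 2 ≤ N) {β x : Fin d → ℝ} {r : ℝ}
    (hs : ∀ᵐ z ∂noiseLaw f, 0 ≤ β ⬝ᵥ x + z) (hr : 0 ≤ r) :
    revenue N β f x r = (∫ z, z ∂(Fminus N f).measure) + β ⬝ᵥ x
      + objective (Fminus N f) (Fplus N f) (β ⬝ᵥ x) r := by
  have := hf.isProbabilityMeasure_noiseLaw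
  set s := β ⬝ᵥ x with hsdef
  have h1 := isBidStatistic_highest hN
  have h2 := isBidStatistic_secondHighest hN
  have hpt : ∀ᵐ e ∂noiseVec N f, ∑ i, payment r (valuation β x e) i
      = (s + secondHighest e) + max (r - (s + secondHighest e)) 0
        - {e | highest e < r - s}.indicator (fun _ => r) e := by
    filter_upwards [ae_injective hf] with e he
    have hinj : Function.Injective (valuation β x e) := fun i j hij =>
      he (add_left_cancel hij)
    rw [sum_payment hN hinj, show valuation β x e = fun i => s + e i from rfl, h2.shift, h1.shift]
    simp only [indicator_apply, mem_ofPred_eq, lt_sub_iff_add_lt']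
  have i2 := integrable_statistic hf h2
  have i3 : Integrable (fun e : Fin N → ℝ => s + secondHighest e) (noiseVec N f) :=
    (integrable_const s).add i2
  have i4 : Integrable (fun e : Fin N → ℝ => max (r - (s + secondHighest e)) 0) (noiseVec N f) :=
    ((integrable_const r).sub i3).pos_part
  have hm : MeasurableSet {e : Fin N → ℝ | highest e < r - s} := h1.measurable measurableSet_Iio
  rw [revenue, integral_congr_ae hpt,
    integral_sub (f := fun e => (s + secondHighest e) + max (r - (s + secondHighest e)) 0)
      (i3.add i4) ((integrable_const r).indicator hm),
    integral_add i3 i4, integral_add (integrable_const s) i2, integral_shortfall hf h2 hs hr,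
    integral_indicator_const _ hm, statCdf_lt hf h1, integral_Fminus hf hN, objective,
    Fplus_eq_statCdf hf hN, Fminus_eq_statCdf hf hN]
  simp
  ring

end NoiseLaw

end NPAC

namespace NPAC

/-! ### Uniform deviations over classes of polynomial growth -/

section UniformDeviation

/-- The sign `±1` encoded by a Boolean. -/
def signOf (b : Bool) : ℝ := if b then 1 else -1

/-- The signs are independent, so the sum factors into hyperbolic cosines, each bounded by `cosh u ≤
exp (u ^ 2 / 2)`. -/
lemma sum_exp_rademacher {n : ℕ} (a : Fin n → ℝ) (ha : ∀ i, |a i| ≤ 1) (l : ℝ) :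
    ∑ σ : Fin n → Bool, Real.exp (l * ∑ i, signOf (σ i) * a i)
      ≤ 2 ^ n * Real.exp (l ^ 2 * n / 2) := by
  have h1 : ∀ σ : Fin n → Bool, Real.exp (l * ∑ i, signOf (σ i) * a i)
      = ∏ i, Real.exp (l * (signOf (σ i) * a i)) := by
    intro σ
    rw [Finset.mul_sum, Real.exp_sum]
  simp only [h1]
  rw [← Fintype.prod_sum (fun i (s : Bool) => Real.exp (l * (signOf s * a i)))]
  have h2 : ∀ i, ∑ s : Bool, Real.exp (l * (signOf s * a i)) ≤ 2 * Real.exp (l ^ 2 / 2) := by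
    intro i
    have h3 : ∑ s : Bool, Real.exp (l * (signOf s * a i)) = 2 * Real.cosh (l * a i) := by
      rw [Fintype.sum_bool, Real.cosh_eq]
      simp [signOf]
      ring
    rw [h3]
    have h4 : (l * a i) ^ 2 ≤ l ^ 2 := by
      rw [mul_pow]
      exact mul_le_of_le_one_right (sq_nonneg l) ((sq_le_one_iff_abs_le_one _).2 (ha i))
    have h5 := Real.cosh_le_exp_half_sq (l * a i)
    have h6 : Real.exp ((l * a i) ^ 2 / 2) ≤ Real.exp (l ^ 2 / 2) :=
      Real.exp_le_exp.2 (by linarith)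
    linarith
  calc ∏ i, ∑ s : Bool, Real.exp (l * (signOf s * a i))
      ≤ ∏ _i : Fin n, 2 * Real.exp (l ^ 2 / 2) :=
        Finset.prod_le_prod (fun i _ => Finset.sum_nonneg fun s _ => (Real.exp_pos _).le)
          fun i _ => h2 i
    _ = 2 ^ n * Real.exp (l ^ 2 * n / 2) := by
        rw [Finset.prod_const, Finset.card_univ, Fintype.card_fin, mul_pow, ← Real.exp_nat_mul]
        ring_nf

/-- Massart's finite class lemma: the Rademacher average of a finite set of vectors with entries
in `[-1, 1]`. -/
lemma sum_rademacher_max_le {n : ℕ} (hn : 1 ≤ n) (V : Finset (Fin n → ℝ))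
    (hV : ∀ a ∈ V, ∀ i, |a i| ≤ 1) {M : ℕ} (hM : V.card ≤ M) (m : (Fin n → Bool) → ℝ)
    (hm : ∀ σ, ∃ a ∈ V, m σ = |∑ i, signOf (σ i) * a i|) :
    ∑ σ, m σ ≤ 2 ^ n * √(2 * n * Real.log (2 * M)) := by
  have hn0 : (0 : ℝ) < n := by exact_mod_cast hn
  have hM1 : 1 ≤ M := by
    obtain ⟨a, ha, -⟩ := hm fun _ => true
    exact (Nat.succ_le_of_lt (Finset.card_pos.2 ⟨a, ha⟩)).trans hM
  have hM1' : (1 : ℝ) ≤ M := by exact_mod_cast hM1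
  set L := Real.log (2 * M) with hL
  have hL0 : 0 < L := Real.log_pos (by linarith)
  -- This value optimizes the Chernoff bound: it makes `l ^ 2 * n / 2` equal to `L`.
  set l := √(2 * L / n) with hl
  have hl0 : 0 < l := Real.sqrt_pos.2 (by positivity)
  have hl2 : l ^ 2 * n = 2 * L := by
    rw [hl, Real.sq_sqrt (by positivity)]
    field_simp
  set K := 2 * (M : ℝ) * Real.exp (l ^ 2 * n / 2) with hK
  have hK0 : 0 < K := by positivity
  have hlogK : Real.log K = 2 * L := by
    rw [hK, Real.log_mul (by positivity) (Real.exp_ne_zero _), Real.log_exp, ← hL, hl2]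
    ring
  have hexp : ∑ σ, Real.exp (l * m σ) ≤ 2 ^ n * K := by
    calc ∑ σ, Real.exp (l * m σ)
        ≤ ∑ σ : Fin n → Bool, ∑ a ∈ V, (Real.exp (l * ∑ i, signOf (σ i) * a i)
            + Real.exp (-l * ∑ i, signOf (σ i) * a i)) := by
          refine Finset.sum_le_sum fun σ _ => ?_
          obtain ⟨a, ha, hma⟩ := hm σ
          refine le_trans ?_ (Finset.single_le_sum (fun b _ =>
            (add_pos (Real.exp_pos _) (Real.exp_pos _)).le) ha)
          rw [hma]
          rcases abs_cases (∑ i, signOf (σ i) * a i) with ⟨h, -⟩ | ⟨h, -⟩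
          · rw [h]; linarith [Real.exp_pos (-l * ∑ i, signOf (σ i) * a i)]
          · rw [h, mul_neg, ← neg_mul]; linarith [Real.exp_pos (l * ∑ i, signOf (σ i) * a i)]
      _ = ∑ a ∈ V, (∑ σ : Fin n → Bool, Real.exp (l * ∑ i, signOf (σ i) * a i)
            + ∑ σ : Fin n → Bool, Real.exp (-l * ∑ i, signOf (σ i) * a i)) := by
          rw [Finset.sum_comm]
          exact Finset.sum_congr rfl fun a _ => Finset.sum_add_distrib
      _ ≤ ∑ _a ∈ V, (2 * 2 ^ n * Real.exp (l ^ 2 * n / 2)) := by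
          refine Finset.sum_le_sum fun a ha => ?_
          have h1 := sum_exp_rademacher a (hV a ha) l
          have h2 := sum_exp_rademacher a (hV a ha) (-l)
          rw [neg_sq] at h2
          linarith
      _ = V.card * (2 * 2 ^ n * Real.exp (l ^ 2 * n / 2)) := by
          rw [Finset.sum_const, nsmul_eq_mul]
      _ ≤ M * (2 * 2 ^ n * Real.exp (l ^ 2 * n / 2)) := by
          gcongr
      _ = 2 ^ n * K := by rw [hK]; ring
  -- The tangent of the logarithm at `K` plays the role of Jensen's inequality for the average over
  -- signs.
  have hlin : ∀ σ, l * m σ ≤ Real.log K + Real.exp (l * m σ) / K - 1 := by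
    intro σ
    have h1 := Real.add_one_le_exp (l * m σ - Real.log K)
    rw [Real.exp_sub, Real.exp_log hK0] at h1
    linarith
  have hsum : l * ∑ σ, m σ ≤ 2 ^ n * (2 * L) := by
    calc l * ∑ σ, m σ ≤ ∑ σ, (Real.log K + Real.exp (l * m σ) / K - 1) := by
          rw [Finset.mul_sum]; exact Finset.sum_le_sum fun σ _ => hlin σ
      _ = 2 ^ n * Real.log K + (∑ σ, Real.exp (l * m σ)) / K - 2 ^ n := by
          rw [Finset.sum_sub_distrib, Finset.sum_add_distrib, ← Finset.sum_div]
          simp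
      _ ≤ 2 ^ n * Real.log K + 2 ^ n * K / K - 2 ^ n := by gcongr
      _ = 2 ^ n * (2 * L) := by
          rw [hlogK, mul_div_cancel_right₀ _ hK0.ne']; ring
  have hmul : l * √(2 * n * L) = 2 * L := by
    rw [hl, ← Real.sqrt_mul (by positivity), show 2 * L / n * (2 * n * L) = (2 * L) ^ 2 by
      field_simp, Real.sqrt_sq (by positivity)]
  refine le_of_mul_le_mul_left ?_ hl0
  calc l * ∑ σ, m σ ≤ 2 ^ n * (2 * L) := hsum
    _ = l * (2 ^ n * √(2 * n * L)) := by rw [← hmul]; ring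

variable {X ι : Type*} [MeasurableSpace X]

/-- Swaps the two points of every pair whose sign is negative. -/
def signSwap {n : ℕ} (σ : Fin n → Bool) (p : Fin n → X × X) : Fin n → X × X :=
  fun i => if σ i then p i else (p i).swap

/-- The two points of a pair are independent with the same law, so exchanging them pair by pair
leaves the joint law unchanged; this is what allows random signs to be inserted. -/
lemma measurePreserving_signSwap {n : ℕ} (μ : Measure X) [IsProbabilityMeasure μ]
    (σ : Fin n → Bool) :
    MeasurePreserving (signSwap σ) (Measure.pi fun _ : Fin n => μ.prod μ)
      (Measure.pi fun _ : Fin n => μ.prod μ) := by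
  have h : ∀ i, MeasurePreserving (fun q : X × X => if σ i then q else q.swap)
      (μ.prod μ) (μ.prod μ) := by
    intro i
    cases σ i
    · simpa using Measure.measurePreserving_swap (μ := μ) (ν := μ)
    · simpa using! MeasurePreserving.id (μ.prod μ)
  exact measurePreserving_pi (fun _ => μ.prod μ) (fun _ => μ.prod μ) h

open scoped Classical in
/-- The part of the index set of a family of points that lands in a set. -/
noncomputable def pointTrace {J : Type*} [Fintype J] (p : J → X) (A : Set X) : Finset J :=
  Finset.univ.filter fun j => p j ∈ A

lemma mem_pointTrace {J Y : Type*} [Fintype J] {p : J → Y} {A : Set Y} {j : J} :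
    j ∈ pointTrace p A ↔ p j ∈ A := by
  classical
  simp [pointTrace]

/-- Symmetrization and Massart's lemma: the expected uniform deviation of the empirical frequencies
of a countable class of sets which has at most `M` traces on any `2 n` points. -/
lemma lintegral_iSup_deviation_le [Countable ι] [Nonempty ι] {n : ℕ} (hn : 1 ≤ n)
    (μ : Measure X) [IsProbabilityMeasure μ] {A : ι → Set X} (hA : ∀ θ, MeasurableSet (A θ))
    {M : ℕ} (hM : ∀ p : Fin n ⊕ Fin n → X, (range fun θ => pointTrace p (A θ)).ncard ≤ M) :
    ∫⁻ z, ⨆ θ, ENNReal.ofReal |∑ i, ((A θ).indicator (1 : X → ℝ) (z i) - μ.real (A θ))|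
      ∂(Measure.pi fun _ : Fin n => μ) ≤ ENNReal.ofReal √(2 * n * Real.log (2 * M)) := by
  classical
  set ν := Measure.pi fun _ : Fin n => μ with hν
  set κ := Measure.pi fun _ : Fin n => μ.prod μ with hκ
  set F : ι → X → ℝ := fun θ => (A θ).indicator 1 with hF
  have mF : ∀ θ, Measurable (F θ) := fun θ => measurable_one.indicator (hA θ)
  have iF : ∀ θ, Integrable (F θ) μ := fun θ => (integrable_const (1 : ℝ)).indicator (hA θ)
  set Φ : (Fin n → X × X) → ENNReal :=
    fun p => ⨆ θ, ENNReal.ofReal |∑ i, (F θ (p i).1 - F θ (p i).2)| with hΦ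
  have mΦ : Measurable Φ := by
    refine Measurable.iSup fun θ => ENNReal.measurable_ofReal.comp ?_
    have := mF θ
    exact continuous_abs.measurable.comp (by fun_prop)
  -- The mean is replaced by an independent ghost sample: it is the integral over `z'`, and absolute
  -- value and supremum move inside that integral.
  have hghost : ∫⁻ z, ⨆ θ, ENNReal.ofReal |∑ i, (F θ (z i) - μ.real (A θ))| ∂ν
      ≤ ∫⁻ p, Φ p ∂κ := by
    have hstep : ∀ z : Fin n → X, ∀ θ, ENNReal.ofReal |∑ i, (F θ (z i) - μ.real (A θ))|
        ≤ ∫⁻ z', ENNReal.ofReal |∑ i, (F θ (z i) - F θ (z' i))| ∂ν := by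
      intro z θ
      have hint : ∫ z', ∑ i, (F θ (z i) - F θ (z' i)) ∂ν
          = ∑ i, (F θ (z i) - μ.real (A θ)) := by
        have hi : ∀ i : Fin n, Integrable (fun z' : Fin n → X => F θ (z' i)) ν := fun i =>
          integrable_comp_eval (μ := fun _ : Fin n => μ) (iF θ)
        rw [integral_finsetSum (f := fun i (z' : Fin n → X) => F θ (z i) - F θ (z' i)) _
          fun i _ => (integrable_const _).sub (hi i)]
        refine Finset.sum_congr rfl fun i _ => ?_
        rw [integral_sub (integrable_const _) (hi i), integral_comp_eval (μ := fun _ : Fin n => μ)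
          (mF θ).aestronglyMeasurable, hF, integral_indicator_one (hA θ)]
        simp
      rw [← hint, ← Real.norm_eq_abs, ofReal_norm]
      refine (enorm_integral_le_lintegral_enorm _).trans (lintegral_mono fun z' => ?_)
      rw [← ofReal_norm, Real.norm_eq_abs]
    calc ∫⁻ z, ⨆ θ, ENNReal.ofReal |∑ i, (F θ (z i) - μ.real (A θ))| ∂ν
        ≤ ∫⁻ z, ∫⁻ z', Φ (fun i => (z i, z' i)) ∂ν ∂ν := by
          refine lintegral_mono fun z => iSup_le fun θ => (hstep z θ).trans ?_
          exact lintegral_mono fun z' =>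
            le_iSup (fun θ => ENNReal.ofReal |∑ i, (F θ (z i) - F θ (z' i))|) θ
      _ = ∫⁻ q : (Fin n → X) × (Fin n → X), Φ (fun i => (q.1 i, q.2 i)) ∂(ν.prod ν) := by
          have hpair : Measurable fun q : (Fin n → X) × (Fin n → X) => Φ fun i => (q.1 i, q.2 i) :=
            mΦ.comp (by fun_prop)
          rw [lintegral_prod _ hpair.aemeasurable]
      _ = ∫⁻ p, Φ p ∂κ := by
          have hpair : Measurable fun q : (Fin n → X) × (Fin n → X) => Φ fun i => (q.1 i, q.2 i) :=
            mΦ.comp (by fun_prop)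
          rw [← (measurePreserving_arrowProdEquivProdArrow X X (Fin n) (fun _ => μ)
            (fun _ => μ)).lintegral_comp hpair]
          rfl
  have hswap : ∀ σ : Fin n → Bool, ∫⁻ p, Φ p ∂κ = ∫⁻ p, Φ (signSwap σ p) ∂κ := fun σ =>
    ((measurePreserving_signSwap μ σ).lintegral_comp mΦ).symm
  have hΦσ : ∀ σ p, Φ (signSwap σ p)
      = ⨆ θ, ENNReal.ofReal |∑ i, signOf (σ i) * (F θ (p i).1 - F θ (p i).2)| := by
    intro σ p
    simp only [hΦ, signSwap]
    congr 1; funext θ; congr 2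
    refine Finset.sum_congr rfl fun i _ => ?_
    cases σ i <;> simp [signOf]
  have hpt : ∀ p, ∑ σ : Fin n → Bool, Φ (signSwap σ p)
      ≤ ENNReal.ofReal (2 ^ n * √(2 * n * Real.log (2 * M))) := by
    intro p
    set u : Fin n ⊕ Fin n → X := Sum.elim (fun i => (p i).1) (fun i => (p i).2) with hu
    set a : ι → Fin n → ℝ := fun θ i => F θ (p i).1 - F θ (p i).2 with ha
    set T := range fun θ => pointTrace u (A θ) with hT
    set φ : Finset (Fin n ⊕ Fin n) → Fin n → ℝ := fun t i =>
      (if Sum.inl i ∈ t then 1 else 0) - (if Sum.inr i ∈ t then 1 else 0) with hφ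
    -- The difference vector depends on `θ` only through the trace of the set on the `2 n` points,
    -- so at most `M` vectors occur and the supremum is attained.
    have haφ : ∀ θ, a θ = φ (pointTrace u (A θ)) := by
      intro θ; funext i
      simp [ha, hφ, hF, mem_pointTrace, hu, indicator_apply]
    have hTf : (φ '' T).Finite := (toFinite T).image φ
    have hmem : ∀ θ, a θ ∈ φ '' T := fun θ => ⟨_, ⟨θ, rfl⟩, (haφ θ).symm⟩
    have hmax : ∀ σ : Fin n → Bool, ∃ θ, ∀ θ', |∑ i, signOf (σ i) * a θ' i|
        ≤ |∑ i, signOf (σ i) * a θ i| := by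
      intro σ
      obtain ⟨v, ⟨_, ⟨θ, rfl⟩, rfl⟩, hv⟩ := exists_max_image (φ '' T)
        (fun v => |∑ i, signOf (σ i) * v i|) hTf ⟨_, hmem (Classical.arbitrary ι)⟩
      exact ⟨θ, fun θ' => by rw [haφ θ]; exact hv _ (hmem θ')⟩
    choose θs hθs using hmax
    have hle : ∀ σ : Fin n → Bool,
        Φ (signSwap σ p) ≤ ENNReal.ofReal |∑ i, signOf (σ i) * a (θs σ) i| := by
      intro σ
      rw [hΦσ]
      exact iSup_le fun θ => ENNReal.ofReal_le_ofReal (hθs σ θ)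
    refine (Finset.sum_le_sum fun σ _ => hle σ).trans ?_
    rw [← ENNReal.ofReal_sum_of_nonneg fun _ _ => abs_nonneg _]
    refine ENNReal.ofReal_le_ofReal (sum_rademacher_max_le hn hTf.toFinset ?_ ?_ _
      fun σ => ⟨a (θs σ), hTf.mem_toFinset.2 (hmem _), rfl⟩)
    · intro v hv i
      obtain ⟨t, -, rfl⟩ := hTf.mem_toFinset.1 hv
      simp only [hφ]
      split_ifs <;> simp
    · rw [← ncard_eq_toFinset_card _ hTf]
      exact (ncard_image_le (toFinite T)).trans (hM u)
  -- All `2 ^ n` sign patterns yield the same integral, so it suffices to bound their sum pointwise.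
  have htotal : (2 : ENNReal) ^ n * ∫⁻ p, Φ p ∂κ
      ≤ 2 ^ n * ENNReal.ofReal √(2 * n * Real.log (2 * M)) := by
    calc (2 : ENNReal) ^ n * ∫⁻ p, Φ p ∂κ
        = ∑ σ : Fin n → Bool, ∫⁻ p, Φ (signSwap σ p) ∂κ := by
          rw [← Finset.sum_congr rfl fun σ _ => hswap σ]
          simp
      _ = ∫⁻ p, ∑ σ : Fin n → Bool, Φ (signSwap σ p) ∂κ := by
          rw [lintegral_finsetSum (f := fun (σ : Fin n → Bool) p => Φ (signSwap σ p)) _ fun σ _ =>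
            mΦ.comp (measurePreserving_signSwap μ σ).measurable]
      _ ≤ ∫⁻ _p, ENNReal.ofReal (2 ^ n * √(2 * n * Real.log (2 * M))) ∂κ :=
          lintegral_mono hpt
      _ = _ := by
          rw [lintegral_const, measure_univ, mul_one, ENNReal.ofReal_mul (by positivity),
            ENNReal.ofReal_pow (by norm_num)]
          simp
  refine hghost.trans ?_
  exact (ENNReal.mul_le_mul_iff_right (by simp) (by simp)).1 htotal

end UniformDeviation

end NPAC

namespace NPAC

/-! ### Half-spaces -/

section HalfSpaces

variable {d : ℕ}

/-- The half-space of the pairs `(x, y)` with `y ≤ w + ⟨b, x⟩`. -/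
def halfSpace (b : Fin d → ℝ) (w : ℝ) : Set ((Fin d → ℝ) × ℝ) := {p | p.2 ≤ w + b ⬝ᵥ p.1}

lemma measurable_dotProduct_const (b : Fin d → ℝ) : Measurable fun x : Fin d → ℝ => b ⬝ᵥ x := by
  unfold dotProduct
  fun_prop

lemma measurableSet_halfSpace (b : Fin d → ℝ) (w : ℝ) : MeasurableSet (halfSpace b w) :=
  measurableSet_le measurable_snd
    (((measurable_dotProduct_const b).comp measurable_fst).const_add w)

/-- Half-spaces of `ℝ^d × ℝ` shatter no set of more than `d + 2` points. -/
lemma card_le_of_shatters {J : Type*} [Fintype J] [DecidableEq J] (u : J → (Fin d → ℝ) × ℝ)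
    {𝒜 : Finset (Finset J)} (h𝒜 : ∀ t ∈ 𝒜, ∃ b w, t = pointTrace u (halfSpace b w))
    {s : Finset J} (hs : 𝒜.Shatters s) : s.card ≤ d + 2 := by
  by_contra! hcard
  set v : s → (Fin d → ℝ) × ℝ × ℝ := fun j => ((u j).1, 1, (u j).2) with hv
  have hdep : ¬ LinearIndependent ℝ v := by
    intro h
    have := h.fintype_card_le_finrank
    simp at this
    omega
  obtain ⟨a, hsum, k, hk⟩ := Fintype.not_linearIndependent_iff.1 hdep
  -- Only points outside a half-space give a strict inequality, so a strictly negative coefficient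
  -- is needed.
  wlog hneg : a k < 0 generalizing a
  · refine this (-a) ?_ (by simpa using hk) ?_
    · simp only [Pi.neg_apply, neg_smul, Finset.sum_neg_distrib, hsum, neg_zero]
    · have := lt_of_le_of_ne (not_lt.1 hneg) (Ne.symm hk)
      simpa using this
  -- Shattering picks out exactly the points with nonnegative coefficient. The relation then sums `a
  -- j * (w + b ⬝ᵥ x - y)` to zero, although every term is nonnegative and the `k`-th is positive.
  obtain ⟨T, hT, hst⟩ := hs (Finset.filter_subset (fun j => ∃ h : j ∈ s, 0 ≤ a ⟨j, h⟩) s)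
  obtain ⟨b, w, rfl⟩ := h𝒜 T hT
  have hmem : ∀ j : s, (u j).2 ≤ w + b ⬝ᵥ (u j).1 ↔ 0 ≤ a j := by
    intro j
    have h := Finset.ext_iff.1 hst j
    rw [Finset.mem_inter, Finset.mem_filter, mem_pointTrace, and_iff_right j.2, and_iff_right j.2] at h
    exact h.trans ⟨fun ⟨_, h⟩ => h, fun h => ⟨j.2, h⟩⟩
  have h1 : ∑ j, a j • (u j).1 = 0 := by
    have := congrArg Prod.fst hsum
    simpa [hv, Prod.fst_sum] using this
  have h2 : ∑ j, a j = 0 := by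
    have := congrArg (fun q : (Fin d → ℝ) × ℝ × ℝ => q.2.1) hsum
    simpa [hv, Prod.snd_sum, Prod.fst_sum] using this
  have h3 : ∑ j, a j * (u j).2 = 0 := by
    have := congrArg (fun q : (Fin d → ℝ) × ℝ × ℝ => q.2.2) hsum
    simpa [hv, Prod.snd_sum] using this
  have h4 : ∑ j, a j * (b ⬝ᵥ (u j).1) = 0 := by
    have := congrArg (fun x => b ⬝ᵥ x) h1
    simpa [dotProduct_sum, dotProduct_smul] using this
  have hzero : ∑ j, a j * (w + b ⬝ᵥ (u j).1 - (u j).2) = 0 := by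
    simp only [mul_sub, mul_add, Finset.sum_sub_distrib, Finset.sum_add_distrib, ← Finset.sum_mul,
      h2, h3, h4]
    ring
  have hpos : ∀ j : s, 0 ≤ a j * (w + b ⬝ᵥ (u j).1 - (u j).2) := by
    intro j
    by_cases h : 0 ≤ a j
    · exact mul_nonneg h (sub_nonneg.2 ((hmem j).2 h))
    · have := mt (hmem j).1 h
      exact mul_nonneg_of_nonpos_of_nonpos (not_le.1 h).le (by linarith)
  have hk0 := (Finset.sum_eq_zero_iff_of_nonneg fun j _ => hpos j).1 hzero k (Finset.mem_univ k)
  have hk1 := mt (hmem k).1 (not_le.2 hneg)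
  exact (mul_pos_of_neg_of_neg hneg (by linarith : w + b ⬝ᵥ (u k).1 - (u k).2 < 0)).ne' hk0

/-- The growth function of half-spaces, by the Sauer-Shelah lemma. -/
lemma ncard_trace_halfSpace_le {J ι : Type*} [Fintype J] (u : J → (Fin d → ℝ) × ℝ)
    (b : ι → Fin d → ℝ) (w : ι → ℝ) :
    (range fun θ => pointTrace u (halfSpace (b θ) (w θ))).ncard ≤ (Fintype.card J + 1) ^ (d + 2) := by
  classical
  set T := range fun θ => pointTrace u (halfSpace (b θ) (w θ))
  set 𝒜 : Finset (Finset J) := (toFinite T).toFinset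
  have h𝒜 : ∀ t ∈ 𝒜, ∃ b w, t = pointTrace u (halfSpace b w) := by
    intro t ht
    obtain ⟨θ, rfl⟩ := (toFinite T).mem_toFinset.1 ht
    exact ⟨_, _, rfl⟩
  have hvc : 𝒜.vcDim ≤ d + 2 :=
    Finset.sup_le fun s hs => card_le_of_shatters u h𝒜 (Finset.mem_shatterer.1 hs)
  rw [ncard_eq_toFinset_card _ (toFinite T)]
  calc 𝒜.card ≤ 𝒜.shatterer.card := 𝒜.card_le_card_shatterer
    _ ≤ ∑ k ∈ Finset.Iic 𝒜.vcDim, (Fintype.card J).choose k := Finset.card_shatterer_le_sum_vcDim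
    _ ≤ ∑ k ∈ Finset.range (d + 2 + 1), (Fintype.card J).choose k := by
        refine Finset.sum_le_sum_of_subset fun k hk => ?_
        have := Finset.mem_Iic.1 hk
        exact Finset.mem_range.2 (by omega)
    -- The factors are inserted so that the sum is the binomial expansion of `(card J + 1) ^ (d +
    -- 2)`.
    _ ≤ ∑ k ∈ Finset.range (d + 2 + 1), Fintype.card J ^ k * 1 ^ (d + 2 - k) * (d + 2).choose k := by
        refine Finset.sum_le_sum fun k hk => ?_
        have h1 : 1 ≤ (d + 2).choose k :=
          Nat.choose_pos (by have := Finset.mem_range.1 hk; omega)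
        calc (Fintype.card J).choose k ≤ Fintype.card J ^ k := Nat.choose_le_pow _ _
          _ ≤ _ := by rw [one_pow, mul_one]; exact Nat.le_mul_of_pos_right _ h1
    _ = (Fintype.card J + 1) ^ (d + 2) := by rw [add_pow]; simp only [Nat.cast_id]

/-- Every half-space is a limit of rational half-spaces, in the sense of pointwise convergence of
indicators on a bounded set of contexts. -/
lemma exists_rat_halfSpace_tendsto (xmax : ℝ) (b : Fin d → ℝ) (w : ℝ) :
    ∃ θ : ℕ → (Fin d → ℚ) × ℚ, ∀ p : (Fin d → ℝ) × ℝ, (∀ j, |p.1 j| ≤ xmax) →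
      ∀ᶠ k in atTop, (p ∈ halfSpace (fun j => ((θ k).1 j : ℝ)) (θ k).2 ↔ p ∈ halfSpace b w) := by
  have hpos : ∀ k : ℕ, (0 : ℝ) < 1 / (k + 1) := fun k => by positivity
  choose q hq1 hq2 using fun (k : ℕ) (j : Fin d) =>
    exists_rat_btwn (show b j < b j + 1 / ((k : ℝ) + 1) by linarith [hpos k])
  -- The rational offset exceeds `w` by more than the error of the slopes, so on the bounded
  -- contexts the approximants contain the half-space. Approaching from outside is what suits a
  -- closed half-space: its boundary points are never lost.
  choose v hv1 hv2 using fun k : ℕ => exists_rat_btwn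
    (show w + d * |xmax| * (1 / ((k : ℝ) + 1)) < w + (d * |xmax| + 1) * (1 / ((k : ℝ) + 1)) by
      linarith [hpos k])
  refine ⟨fun k => (q k, v k), fun p hp => ?_⟩
  have hdiff : ∀ k, |(fun j => (q k j : ℝ)) ⬝ᵥ p.1 - b ⬝ᵥ p.1| ≤ d * |xmax| * (1 / ((k : ℝ) + 1)) := by
    intro k
    rw [← sub_dotProduct]
    calc |((fun j => (q k j : ℝ)) - b) ⬝ᵥ p.1|
        ≤ ∑ j, |((q k j : ℝ) - b j) * p.1 j| := Finset.abs_sum_le_sum_abs _ _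
      _ ≤ ∑ _j : Fin d, 1 / ((k : ℝ) + 1) * |xmax| := by
          refine Finset.sum_le_sum fun j _ => ?_
          rw [abs_mul]
          refine mul_le_mul ?_ ((hp j).trans (le_abs_self _)) (abs_nonneg _) (hpos k).le
          rw [abs_of_pos (by linarith [hq1 k j])]
          linarith [hq2 k j]
      _ = _ := by simp; ring
  by_cases hmem : p ∈ halfSpace b w
  · refine Eventually.of_forall fun k => iff_of_true ?_ hmem
    have h1 := (abs_le.1 (hdiff k)).1
    have h2 : p.2 ≤ w + b ⬝ᵥ p.1 := hmem
    change p.2 ≤ (v k : ℝ) + _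
    linarith [hv1 k]
  · have h2 : w + b ⬝ᵥ p.1 < p.2 := not_le.1 hmem
    have hlim : Tendsto (fun k : ℕ => (2 * d * |xmax| + 1) * (1 / ((k : ℝ) + 1))) atTop
        (𝓝 ((2 * d * |xmax| + 1) * 0)) := tendsto_one_div_add_atTop_nhds_zero_nat.const_mul _
    rw [mul_zero] at hlim
    filter_upwards [hlim.eventually (gt_mem_nhds (sub_pos.2 h2))] with k hk
    refine iff_of_false (fun h => ?_) hmem
    have h3 : p.2 ≤ (v k : ℝ) + (fun j => (q k j : ℝ)) ⬝ᵥ p.1 := h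
    have h1 := (abs_le.1 (hdiff k)).2
    linarith [hv2 k]

open scoped Classical in
/-- Uniform deviation of the empirical frequencies of half-spaces. -/
lemma exists_uniform_deviation (hd : 1 ≤ d) {n : ℕ} (hn : 1 ≤ n) (xmax : ℝ)
    (μ : Measure ((Fin d → ℝ) × ℝ)) [IsProbabilityMeasure μ] (hμ : ∀ᵐ p ∂μ, ∀ j, |p.1 j| ≤ xmax) :
    ∃ Δ : (Fin n → (Fin d → ℝ) × ℝ) → ℝ, Measurable Δ ∧ (∀ z, 0 ≤ Δ z ∧ Δ z ≤ 1) ∧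
      ∫ z, Δ z ∂(Measure.pi fun _ => μ) ≤ √(8 * d * Real.log (2 * n + 1) / n) ∧
      ∀ᵐ z ∂(Measure.pi fun _ => μ), ∀ b w,
        |(1 / (n : ℝ)) * (∑ τ, if (z τ).2 ≤ w + b ⬝ᵥ (z τ).1 then 1 else 0)
          - μ.real (halfSpace b w)| ≤ Δ z := by
  have hn0 : (0 : ℝ) < n := by exact_mod_cast hn
  have hd1 : (1 : ℝ) ≤ d := by exact_mod_cast hd
  -- A countable class makes the supremum measurable; arbitrary parameters are recovered at the end
  -- by `exists_rat_halfSpace_tendsto`.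
  set A : (Fin d → ℚ) × ℚ → Set ((Fin d → ℝ) × ℝ) :=
    fun θ => halfSpace (fun j => (θ.1 j : ℝ)) θ.2 with hA
  have mA : ∀ θ, MeasurableSet (A θ) := fun θ => measurableSet_halfSpace _ _
  set dev : (Fin d → ℚ) × ℚ → (Fin n → (Fin d → ℝ) × ℝ) → ℝ := fun θ z =>
    |∑ i, ((A θ).indicator (1 : (Fin d → ℝ) × ℝ → ℝ) (z i) - μ.real (A θ))| with hdev
  have mdev : ∀ θ, Measurable (dev θ) := by
    intro θ
    have : Measurable ((A θ).indicator (1 : (Fin d → ℝ) × ℝ → ℝ)) :=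
      measurable_one.indicator (mA θ)
    exact continuous_abs.measurable.comp (by fun_prop)
  have devle : ∀ θ z, dev θ z ≤ n := by
    intro θ z
    refine (Finset.abs_sum_le_sum_abs _ _).trans ?_
    calc ∑ i, |(A θ).indicator (1 : (Fin d → ℝ) × ℝ → ℝ) (z i) - μ.real (A θ)|
        ≤ ∑ _i : Fin n, (1 : ℝ) := by
          refine Finset.sum_le_sum fun i _ => ?_
          have h1 : 0 ≤ μ.real (A θ) := measureReal_nonneg
          have h2 : μ.real (A θ) ≤ 1 := measureReal_le_one
          rw [indicator_apply, abs_le]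
          rw [Pi.one_apply]
          split_ifs <;> constructor <;> linarith
      _ = n := by simp
  set S : (Fin n → (Fin d → ℝ) × ℝ) → ENNReal := fun z => ⨆ θ, ENNReal.ofReal (dev θ z) with hS
  have mS : Measurable S := Measurable.iSup fun θ => (mdev θ).ennreal_ofReal
  have Sle : ∀ z, S z ≤ ENNReal.ofReal n := fun z =>
    iSup_le fun θ => ENNReal.ofReal_le_ofReal (devle θ z)
  have Sfin : ∀ z, S z ≠ ⊤ := fun z => ((Sle z).trans_lt ENNReal.ofReal_lt_top).ne
  have hbound := lintegral_iSup_deviation_le hn μ mA (M := (2 * n + 1) ^ (d + 2)) (fun p => by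
    have := ncard_trace_halfSpace_le p (fun θ : (Fin d → ℚ) × ℚ => fun j => (θ.1 j : ℝ))
      fun θ => (θ.2 : ℝ)
    rwa [Fintype.card_sum, Fintype.card_fin, ← two_mul] at this)
  refine ⟨fun z => (S z).toReal / n, mS.ennreal_toReal.div_const _, fun z => ⟨by positivity, ?_⟩,
    ?_, ?_⟩
  · rw [div_le_one hn0]
    exact ENNReal.toReal_le_of_le_ofReal hn0.le (Sle z)
  · rw [integral_div, integral_toReal mS.aemeasurable
      (Eventually.of_forall fun z => (Sfin z).lt_top)]
    have h1 := ENNReal.toReal_le_of_le_ofReal (Real.sqrt_nonneg _) hbound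
    -- The left side is at most `(d + 3) * log (2 n + 1)`, and `d + 3 ≤ 4 d` because `d ≥ 1`.
    have h2 : Real.log (2 * ((2 * n + 1) ^ (d + 2) : ℕ)) ≤ 4 * d * Real.log (2 * n + 1) := by
      have hlog : 0 ≤ Real.log (2 * (n : ℝ) + 1) := Real.log_nonneg (by linarith)
      have h3 : Real.log 2 ≤ Real.log (2 * (n : ℝ) + 1) :=
        Real.log_le_log (by norm_num) (by
          have : (1 : ℝ) ≤ n := by exact_mod_cast hn
          linarith)
      push_cast
      rw [Real.log_mul (by norm_num) (by positivity), Real.log_pow]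
      push_cast
      nlinarith
    calc (∫⁻ z, S z ∂(Measure.pi fun _ => μ)).toReal / n
        ≤ √(2 * n * Real.log (2 * ((2 * n + 1) ^ (d + 2) : ℕ))) / n := by gcongr
      _ ≤ √(2 * n * (4 * d * Real.log (2 * n + 1))) / n := by gcongr
      _ = √(8 * d * Real.log (2 * n + 1) / n) := by
          rw [div_eq_iff hn0.ne', ← Real.sqrt_sq hn0.le, ← Real.sqrt_mul' _ (sq_nonneg _),
            Real.sqrt_sq hn0.le]
          congr 1
          field_simp
          ring
  · have hall : ∀ᵐ z ∂(Measure.pi fun _ : Fin n => μ), ∀ τ j, |(z τ).1 j| ≤ xmax :=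
      ae_all_iff.2 fun τ =>
        (measurePreserving_eval (fun _ : Fin n => μ) τ).quasiMeasurePreserving.ae hμ
    filter_upwards [hall] with z hz b w
    obtain ⟨θ, hθ⟩ := exists_rat_halfSpace_tendsto xmax b w
    have hind : ∀ p : (Fin d → ℝ) × ℝ, (∀ j, |p.1 j| ≤ xmax) →
        Tendsto (fun k => (A (θ k)).indicator (1 : (Fin d → ℝ) × ℝ → ℝ) p) atTop
          (𝓝 ((halfSpace b w).indicator 1 p)) := by
      intro p hp
      refine tendsto_const_nhds.congr' ?_
      filter_upwards [hθ p hp] with k hk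
      simp only [indicator_apply, hA, hk]
    have hμlim : Tendsto (fun k => μ.real (A (θ k))) atTop (𝓝 (μ.real (halfSpace b w))) := by
      simp only [← integral_indicator_one (mA _), ← integral_indicator_one
        (measurableSet_halfSpace b w)]
      refine tendsto_integral_of_dominated_convergence (fun _ => (1 : ℝ))
        (fun k => (measurable_one.indicator (mA _)).aestronglyMeasurable) (integrable_const _)
        (fun k => Eventually.of_forall fun p => ?_) (hμ.mono hind)
      rw [indicator_apply]
      split_ifs <;> simp
    have hdevlim : Tendsto (fun k => dev (θ k) z) atTop (𝓝 |∑ i,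
        ((halfSpace b w).indicator (1 : (Fin d → ℝ) × ℝ → ℝ) (z i) - μ.real (halfSpace b w))|) :=
      (tendsto_finsetSum _ fun i _ => (hind (z i) (hz i)).sub hμlim).abs
    have hle : |∑ i, ((halfSpace b w).indicator (1 : (Fin d → ℝ) × ℝ → ℝ) (z i)
        - μ.real (halfSpace b w))| ≤ (S z).toReal := by
      refine le_of_tendsto hdevlim (Eventually.of_forall fun k => ?_)
      exact (ENNReal.ofReal_le_iff_le_toReal (Sfin z)).1
        (le_iSup (fun θ => ENNReal.ofReal (dev θ z)) (θ k))
    rw [le_div_iff₀ hn0, ← abs_of_pos hn0, ← abs_mul, abs_of_pos hn0]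
    refine le_trans (le_of_eq ?_) hle
    congr 1
    rw [Finset.sum_sub_distrib, sub_mul]
    simp only [indicator_apply, halfSpace, mem_ofPred_eq, Pi.one_apply, Finset.sum_const,
      Finset.card_univ, Fintype.card_fin, nsmul_eq_mul]
    field_simp

end HalfSpaces

end NPAC

namespace NPAC

/-! ### The pseudo-inverse of a Gram matrix -/

section PseudoInverse

variable {d : ℕ}

open Matrix

lemma isMoorePenrose_pinv {A : Matrix (Fin d) (Fin d) ℝ} (hA : A.IsHermitian) :
    IsMoorePenrose A (pinv A) := by
  have h := exists_isMoorePenrose hA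
  rw [pinv, dif_pos h]
  exact h.choose_spec

lemma IsMoorePenrose.pinv_eq {A B : Matrix (Fin d) (Fin d) ℝ} (h : IsMoorePenrose A B) :
    pinv A = B := by
  have h' : ∃ B, IsMoorePenrose A B := ⟨B, h⟩
  rw [pinv, dif_pos h']
  exact h'.choose_spec.unique h

lemma IsMoorePenrose.isSymm {A B : Matrix (Fin d) (Fin d) ℝ} (h : IsMoorePenrose A B)
    (hA : A.IsSymm) : B.IsSymm := by
  refine IsMoorePenrose.unique (A := A) ⟨?_, ?_, ?_, ?_⟩ h
  · have := congrArg transpose h.mul_mul_left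
    simpa [transpose_mul, hA.eq, Matrix.mul_assoc] using this
  · have := congrArg transpose h.mul_mul_right
    simpa [transpose_mul, hA.eq, Matrix.mul_assoc] using this
  · have := h.symm_right
    rw [← this.eq, transpose_mul, hA.eq] at this
    exact this
  · have := h.symm_left
    rw [← this.eq, transpose_mul, hA.eq] at this
    exact this

/-- The pseudo-inverse is a Borel function, since its graph is closed. -/
lemma measurable_pinv_apply (i j : Fin d) :
    Measurable fun A : Fin d → Fin d → ℝ => pinv (Matrix.of A) i j := by
  set E := Fin d → Fin d → ℝ
  set S : Set (E × E) := {p | IsMoorePenrose (Matrix.of p.1) (Matrix.of p.2)} with hS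
  have hSm : MeasurableSet S := by
    have hS' : S = {p | Matrix.of p.1 * Matrix.of p.2 * Matrix.of p.1 = Matrix.of p.1} ∩
        {p | Matrix.of p.2 * Matrix.of p.1 * Matrix.of p.2 = Matrix.of p.2} ∩
        {p | (Matrix.of p.1 * Matrix.of p.2)ᵀ = Matrix.of p.1 * Matrix.of p.2} ∩
        {p | (Matrix.of p.2 * Matrix.of p.1)ᵀ = Matrix.of p.2 * Matrix.of p.1} := by
      ext p
      exact ⟨fun h => ⟨⟨⟨h.1, h.2⟩, h.3⟩, h.4⟩, fun h => ⟨h.1.1.1, h.1.1.2, h.1.2, h.2⟩⟩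
    have c1 : Continuous fun p : E × E => (Matrix.of p.1 : Matrix (Fin d) (Fin d) ℝ) :=
      continuous_fst
    have c2 : Continuous fun p : E × E => (Matrix.of p.2 : Matrix (Fin d) (Fin d) ℝ) :=
      continuous_snd
    have c12 := c1.matrix_mul c2
    have c21 := c2.matrix_mul c1
    rw [hS']
    refine IsClosed.measurableSet ?_
    exact (((isClosed_eq (c12.matrix_mul c1) c1).inter (isClosed_eq (c21.matrix_mul c2) c2)).inter
      (isClosed_eq c12.matrix_transpose c12)).inter (isClosed_eq c21.matrix_transpose c21)
  -- By uniqueness of the pseudo-inverse the first projection is injective on the graph. An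
  -- injective Borel map out of a standard Borel space is a measurable embedding (Lusin-Souslin), so
  -- the second coordinate is a Borel function of the first.
  have : StandardBorelSpace S := hSm.standardBorel
  have hφ : Measurable fun p : S => p.1.1 := measurable_fst.comp measurable_subtype_coe
  have hinj : Function.Injective fun p : S => p.1.1 := by
    rintro ⟨⟨A, B⟩, hp⟩ ⟨⟨A', B'⟩, hp'⟩ h
    obtain rfl : A = A' := h
    obtain rfl : B = B' := IsMoorePenrose.unique hp hp'
    rfl
  have hemb := hφ.measurableEmbedding hinj
  have hext : (fun A : E => (pinv (Matrix.of A) : Matrix (Fin d) (Fin d) ℝ) i j)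
      = Function.extend (fun p : S => p.1.1) (fun p : S => p.1.2 i j) 0 := by
    funext A
    by_cases h : ∃ B, IsMoorePenrose (Matrix.of A) B
    · obtain ⟨B, hB⟩ := h
      have := hinj.extend_apply (fun p : S => p.1.2 i j) 0 ⟨(A, B), hB⟩
      rw [this, hB.pinv_eq]
    · rw [Function.extend_apply', pinv, dif_neg h]
      · rfl
      · rintro ⟨⟨⟨A', B⟩, hp⟩, rfl⟩
        exact h ⟨B, hp⟩
  rw [hext]
  refine hemb.measurable_extend ?_ measurable_zero
  have : Measurable fun p : E × E => p.2 i j := by fun_prop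
  exact this.comp measurable_subtype_coe

variable {n : ℕ}

/-- The Gram matrix `∑ x_τ x_τᵀ`. -/
def gram (xs : Fin n → Fin d → ℝ) : Matrix (Fin d) (Fin d) ℝ := ∑ τ, vecMulVec (xs τ) (xs τ)

lemma isHermitian_vecMulVec (x : Fin d → ℝ) : (vecMulVec x x).IsHermitian := by
  ext i j
  simp [vecMulVec_apply, mul_comm]

lemma isHermitian_gram (xs : Fin n → Fin d → ℝ) : (gram xs).IsHermitian := by
  rw [Matrix.IsHermitian, gram, conjTranspose_sum]
  exact Finset.sum_congr rfl fun τ _ => (isHermitian_vecMulVec (xs τ)).eq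

lemma isSymm_gram (xs : Fin n → Fin d → ℝ) : (gram xs).IsSymm := by
  have := (isHermitian_gram xs).eq
  rwa [conjTranspose_eq_transpose_of_trivial] at this

lemma gram_mulVec (xs : Fin n → Fin d → ℝ) (v : Fin d → ℝ) :
    gram xs *ᵥ v = ∑ τ, (xs τ ⬝ᵥ v) • xs τ := by
  rw [gram, sum_mulVec]
  refine Finset.sum_congr rfl fun τ _ => ?_
  rw [vecMulVec_mulVec, op_smul_eq_smul]

lemma dotProduct_gram_mulVec (xs : Fin n → Fin d → ℝ) (v : Fin d → ℝ) :
    v ⬝ᵥ (gram xs *ᵥ v) = ∑ τ, (xs τ ⬝ᵥ v) ^ 2 := by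
  rw [gram_mulVec, dotProduct_sum]
  refine Finset.sum_congr rfl fun τ _ => ?_
  rw [dotProduct_smul, smul_eq_mul, dotProduct_comm v, sq]

lemma symm_mulVec_dotProduct {A : Matrix (Fin d) (Fin d) ℝ} (hA : A.IsSymm) (v w : Fin d → ℝ) :
    (A *ᵥ v) ⬝ᵥ w = v ⬝ᵥ (A *ᵥ w) := by
  rw [dotProduct_mulVec, ← mulVec_transpose, hA.eq]

/-- Every summand of a Gram matrix lies in its range. -/
lemma gram_mulVec_pinv (xs : Fin n → Fin d → ℝ) (i : Fin n) :
    gram xs *ᵥ (pinv (gram xs) *ᵥ xs i) = xs i := by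
  set A := gram xs
  set B := pinv A
  have hA : A.IsSymm := isSymm_gram xs
  have hB : IsMoorePenrose A B := isMoorePenrose_pinv (isHermitian_gram xs)
  -- The residual `e` is killed by `A`, hence is orthogonal to every `xs τ` and to the range of `A`,
  -- and so to itself.
  set e := xs i - A *ᵥ (B *ᵥ xs i) with he
  have hAAB : A * (A * B) = A := by
    calc A * (A * B) = Aᵀ * (A * B)ᵀ := by rw [hA.eq, hB.symm_left.eq]
      _ = (A * B * A)ᵀ := (transpose_mul _ _).symm
      _ = A := by rw [hB.mul_mul_left, hA.eq]
  have hAe : A *ᵥ e = 0 := by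
    rw [he, mulVec_sub, mulVec_mulVec, mulVec_mulVec, Matrix.mul_assoc, hAAB, sub_self]
  have hsum : ∑ τ, (xs τ ⬝ᵥ e) ^ 2 = 0 := by
    rw [← dotProduct_gram_mulVec, hAe, dotProduct_zero]
  have hxe : xs i ⬝ᵥ e = 0 := by
    have := (Finset.sum_eq_zero_iff_of_nonneg fun τ _ => sq_nonneg _).1 hsum i (Finset.mem_univ i)
    exact pow_eq_zero_iff (two_ne_zero) |>.1 this
  have hee : e ⬝ᵥ e = 0 := by
    have h1 : e ⬝ᵥ (A *ᵥ (B *ᵥ xs i)) = 0 := by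
      rw [← symm_mulVec_dotProduct hA, hAe, zero_dotProduct]
    calc e ⬝ᵥ e = e ⬝ᵥ xs i - e ⬝ᵥ (A *ᵥ (B *ᵥ xs i)) := by rw [← dotProduct_sub]
      _ = 0 := by rw [h1, dotProduct_comm, hxe, sub_zero]
  exact (sub_eq_zero.1 (dotProduct_self_eq_zero.1 hee)).symm

/-- The sum is the trace of `A† A`, a symmetric idempotent. Each diagonal entry is the sum of
squares of its row, hence dominates its own square and is at most one. -/
lemma sum_dotProduct_pinv_gram_le (xs : Fin n → Fin d → ℝ) :
    ∑ i, xs i ⬝ᵥ (pinv (gram xs) *ᵥ xs i) ≤ d := by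
  set A := gram xs with hA'
  set B := pinv A
  have hB : IsMoorePenrose A B := isMoorePenrose_pinv (isHermitian_gram xs)
  have htr : ∑ i, xs i ⬝ᵥ (B *ᵥ xs i) = (B * A).trace := by
    rw [hA', gram, Matrix.mul_sum, trace_sum]
    refine Finset.sum_congr rfl fun i _ => ?_
    rw [mul_vecMulVec, trace_vecMulVec, dotProduct_comm]
  have hP : (B * A) * (B * A) = B * A := by
    rw [← Matrix.mul_assoc, hB.mul_mul_right]
  have hdiag : ∀ k, (B * A) k k ≤ 1 := by
    intro k
    have h1 : (B * A) k k = ∑ j, (B * A) k j ^ 2 := by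
      conv_lhs => rw [← hP]
      rw [Matrix.mul_apply]
      refine Finset.sum_congr rfl fun j _ => ?_
      rw [hB.symm_right.apply j k, sq]
    have h2 : (B * A) k k ^ 2 ≤ (B * A) k k := by
      conv_rhs => rw [h1]
      exact Finset.single_le_sum (f := fun j => (B * A) k j ^ 2) (fun j _ => sq_nonneg _)
        (Finset.mem_univ k)
    nlinarith
  rw [htr, trace]
  calc ∑ k, (B * A).diag k ≤ ∑ _k : Fin d, (1 : ℝ) := Finset.sum_le_sum fun k _ => hdiag k
    _ = d := by simp

/-- The leverage of a new context `x` relative to past contexts `xs`. -/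
noncomputable def leverage (xs : Fin n → Fin d → ℝ) (x : Fin d → ℝ) : ℝ :=
  x ⬝ᵥ (pinv (vecMulVec x x + gram xs) *ᵥ x)

lemma vecMulVec_add_gram (xs : Fin n → Fin d → ℝ) (x : Fin d → ℝ) :
    vecMulVec x x + gram xs = gram (Fin.cons x xs : Fin (n + 1) → Fin d → ℝ) := by
  rw [gram, gram, Fin.sum_univ_succ]
  simp

lemma gram_succAbove (ys : Fin (n + 1) → Fin d → ℝ) (i : Fin (n + 1)) :
    vecMulVec (ys i) (ys i) + gram (fun j => ys (i.succAbove j)) = gram ys := by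
  rw [gram, gram, Fin.sum_univ_succAbove _ i]

/-- Because the leverage includes `x` in its own Gram matrix, all leave-one-out leverages refer to
the same full Gram matrix. -/
lemma sum_leverage_le (ys : Fin (n + 1) → Fin d → ℝ) :
    ∑ i, leverage (fun j => ys (i.succAbove j)) (ys i) ≤ d := by
  simp only [leverage, gram_succAbove]
  exact sum_dotProduct_pinv_gram_le ys

lemma leverage_mulVec (xs : Fin n → Fin d → ℝ) (x : Fin d → ℝ) :
    (vecMulVec x x + gram xs) *ᵥ (pinv (vecMulVec x x + gram xs) *ᵥ x) = x := by
  have h := gram_mulVec_pinv (Fin.cons x xs : Fin (n + 1) → Fin d → ℝ) 0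
  rwa [← vecMulVec_add_gram, Fin.cons_zero] at h

lemma leverage_nonneg (xs : Fin n → Fin d → ℝ) (x : Fin d → ℝ) : 0 ≤ leverage xs x := by
  have h := leverage_mulVec xs x
  rw [vecMulVec_add_gram] at h
  rw [leverage, vecMulVec_add_gram]
  set w := pinv (gram (Fin.cons x xs : Fin (n + 1) → Fin d → ℝ)) *ᵥ x
  rw [← h, dotProduct_comm, dotProduct_gram_mulVec]
  exact Finset.sum_nonneg fun _ _ => sq_nonneg _

lemma leverage_le (xs : Fin n → Fin d → ℝ) (x : Fin d → ℝ) : leverage xs x ≤ d := by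
  have h := sum_leverage_le (Fin.cons x xs : Fin (n + 1) → Fin d → ℝ)
  rw [Fin.sum_univ_succ] at h
  simp only [Fin.succAbove_zero, Fin.cons_succ, Fin.cons_zero] at h
  exact (le_add_of_nonneg_right (Finset.sum_nonneg fun _ _ => leverage_nonneg _ _)).trans h

/-- If the leverage of `x` is at most `1/2`, then `x` lies in the span of the past contexts and
its squared norm in the metric of the pseudo-inverse is at most twice the leverage. -/
lemma pinv_gram_of_leverage_le (xs : Fin n → Fin d → ℝ) (x : Fin d → ℝ)
    (h : leverage xs x ≤ 1 / 2) :
    (pinv (gram xs) * gram xs) *ᵥ x = x ∧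
      ∑ τ, (xs τ ⬝ᵥ (pinv (gram xs) *ᵥ x)) ^ 2 ≤ 2 * leverage xs x := by
  set A := gram xs with hA'
  set C := pinv A
  have hA : A.IsSymm := isSymm_gram xs
  have hC : IsMoorePenrose A C := isMoorePenrose_pinv (isHermitian_gram xs)
  have hCs : C.IsSymm := hC.isSymm hA
  set q := leverage xs x with hq
  set w := pinv (vecMulVec x x + gram xs) *ᵥ x with hw
  have hxw : x ⬝ᵥ w = q := rfl
  have hq0 : 0 ≤ q := leverage_nonneg xs x
  -- The equation `(x xᵀ + A) w = x` reads `A w = (1 - q) x`, and `q ≤ 1/2` permits division by `1 -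
  -- q`.
  have hAw : A *ᵥ w = (1 - q) • x := by
    have h1 := leverage_mulVec xs x
    rw [add_mulVec, vecMulVec_mulVec, op_smul_eq_smul, ← hw, hxw] at h1
    rw [sub_smul, one_smul]
    exact eq_sub_of_add_eq' h1
  set w' := (1 - q)⁻¹ • w with hw'
  have hx : A *ᵥ w' = x := by
    rw [hw', mulVec_smul, hAw, smul_smul, inv_mul_cancel₀ (by linarith), one_smul]
  have hCAA : C * A * A = A := by
    calc C * A * A = (C * A)ᵀ * Aᵀ := by rw [hA.eq, hC.symm_right.eq]
      _ = (A * (C * A))ᵀ := (transpose_mul _ _).symm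
      _ = A := by rw [← Matrix.mul_assoc, hC.mul_mul_left, hA.eq]
  have hproj : (C * A) *ᵥ x = x := by
    rw [← hx, mulVec_mulVec, hCAA]
  refine ⟨hproj, ?_⟩
  -- A Sherman-Morrison identity; the value `q / (1 - q)` is at most `2 q`.
  have hval : x ⬝ᵥ (C *ᵥ x) = (1 - q)⁻¹ * q := by
    calc x ⬝ᵥ (C *ᵥ x) = (A *ᵥ w') ⬝ᵥ (C *ᵥ (A *ᵥ w')) := by rw [hx]
      _ = w' ⬝ᵥ ((A * C * A) *ᵥ w') := by
          rw [symm_mulVec_dotProduct hA, mulVec_mulVec, mulVec_mulVec, Matrix.mul_assoc]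
      _ = w' ⬝ᵥ x := by rw [hC.mul_mul_left, hx]
      _ = (1 - q)⁻¹ * q := by rw [hw', smul_dotProduct, dotProduct_comm, hxw, smul_eq_mul]
  rw [← dotProduct_gram_mulVec, mulVec_mulVec, symm_mulVec_dotProduct hCs, mulVec_mulVec,
    ← Matrix.mul_assoc, hC.mul_mul_right, hval, inv_mul_eq_div, div_le_iff₀ (by linarith)]
  nlinarith

lemma measurable_leverage :
    Measurable fun p : (Fin d → ℝ) × (Fin n → Fin d → ℝ) => leverage p.2 p.1 := by
  have h : ∀ i j, Measurable fun p : (Fin d → ℝ) × (Fin n → Fin d → ℝ) =>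
      pinv (vecMulVec p.1 p.1 + gram p.2) i j := by
    intro i j
    refine (measurable_pinv_apply i j).comp
      (g := fun A : Fin d → Fin d → ℝ => pinv (Matrix.of A) i j)
      (f := fun p : (Fin d → ℝ) × (Fin n → Fin d → ℝ) => (vecMulVec p.1 p.1 + gram p.2)) ?_
    refine measurable_pi_iff.2 fun k => measurable_pi_iff.2 fun l => ?_
    simp only [gram, Matrix.add_apply, Matrix.sum_apply, vecMulVec_apply]
    fun_prop
  simp only [leverage, dotProduct, mulVec]
  fun_prop

lemma betaHat_eq {N : ℕ} (h : History d N n) : betaHat h = pinv (gram fun τ => (h τ).1) *ᵥ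
    ∑ τ, ((1 / (N : ℝ)) * ∑ i, (h τ).2 i) • (h τ).1 := rfl

lemma measurable_betaHat {N : ℕ} (i : Fin d) :
    Measurable fun h : History d N n => betaHat h i := by
  have h : ∀ i j, Measurable fun h : History d N n =>
      pinv (gram fun τ => (h τ).1) i j := by
    intro i j
    refine (measurable_pinv_apply i j).comp
      (g := fun A : Fin d → Fin d → ℝ => pinv (Matrix.of A) i j)
      (f := fun h : History d N n => gram fun τ => (h τ).1) ?_
    refine measurable_pi_iff.2 fun k => measurable_pi_iff.2 fun l => ?_
    simp only [gram, Matrix.sum_apply, vecMulVec_apply]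
    fun_prop
  simp only [betaHat_eq, mulVec, dotProduct, Finset.sum_apply, Pi.smul_apply, smul_eq_mul]
  fun_prop

end PseudoInverse

end NPAC

namespace NPAC

/-! ### The prediction error of least squares -/

section PredictionError

variable {d N n : ℕ} {εmax : ℝ} {f : ℝ → ℝ}

open Matrix

/-- The average of the noises of one period. -/
noncomputable def meanNoise (e : Fin N → ℝ) : ℝ := (1 / (N : ℝ)) * ∑ i, e i

/-- The error of the least squares prediction of `⟨β, x⟩`, given past contexts and noises. -/
noncomputable def predError (β : Fin d → ℝ) (h : History d N n) (x : Fin d → ℝ) : ℝ :=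
  (betaHat (truthfulHistory β h) - β) ⬝ᵥ x

lemma measurable_meanNoise : Measurable (meanNoise : (Fin N → ℝ) → ℝ) := by
  unfold meanNoise
  fun_prop

lemma measurable_truthfulHistory (β : Fin d → ℝ) :
    Measurable (truthfulHistory β : History d N n → History d N n) := by
  unfold truthfulHistory valuation dotProduct
  fun_prop

lemma measurable_predError (β : Fin d → ℝ) :
    Measurable fun p : History d N n × (Fin d → ℝ) => predError β p.1 p.2 := by
  have h1 : ∀ i, Measurable ((fun h : History d N n => betaHat h i) ∘ truthfulHistory β) :=
    fun i => (measurable_betaHat i).comp (measurable_truthfulHistory β)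
  have h2 : (fun p : History d N n × (Fin d → ℝ) => predError β p.1 p.2) = fun p =>
      ∑ i, (((fun h : History d N n => betaHat h i) ∘ truthfulHistory β) p.1 - β i) * p.2 i := rfl
  rw [h2]
  exact Finset.measurable_sum _ fun i _ => (((h1 i).comp measurable_fst).sub_const _).mul
    ((measurable_pi_apply i).comp measurable_snd)

/-- The signal part of the estimate is `A† A β`. By symmetry `A† A` moves onto `x`, which it fixes,
so the prediction has no bias and only a linear combination of noises remains. -/
lemma predError_eq (hN : 2 ≤ N) (β : Fin d → ℝ) (h : History d N n) (x : Fin d → ℝ)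
    (hx : (pinv (gram fun τ => (h τ).1) * gram fun τ => (h τ).1) *ᵥ x = x) :
    predError β h x
      = ∑ τ, ((h τ).1 ⬝ᵥ (pinv (gram fun τ => (h τ).1) *ᵥ x)) * meanNoise (h τ).2 := by
  set xs : Fin n → Fin d → ℝ := fun τ => (h τ).1
  set A := gram xs with hA'
  set C := pinv A
  have hA : A.IsSymm := isSymm_gram xs
  have hC : IsMoorePenrose A C := isMoorePenrose_pinv (isHermitian_gram xs)
  have hN0 : (N : ℝ) ≠ 0 := by
    have : N ≠ 0 := by omega
    exact_mod_cast this
  have hval : ∀ τ, (1 / (N : ℝ)) * ∑ i, valuation β (h τ).1 (h τ).2 i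
      = xs τ ⬝ᵥ β + meanNoise (h τ).2 := by
    intro τ
    simp only [valuation, Finset.sum_add_distrib, meanNoise, mul_add]
    rw [dotProduct_comm]
    simp [hN0, xs]
  have hb : betaHat (truthfulHistory β h)
      = C *ᵥ (A *ᵥ β) + C *ᵥ ∑ τ, meanNoise (h τ).2 • xs τ := by
    rw [betaHat_eq, ← mulVec_add, hA', gram_mulVec, ← Finset.sum_add_distrib]
    change C *ᵥ _ = _
    congr 1
    refine Finset.sum_congr rfl fun τ _ => ?_
    rw [← add_smul, ← hval]
    rfl
  rw [predError, hb, sub_dotProduct, add_dotProduct, mulVec_mulVec,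
    symm_mulVec_dotProduct hC.symm_right, hx, symm_mulVec_dotProduct (hC.isSymm hA),
    sum_dotProduct]
  simp only [smul_dotProduct, smul_eq_mul, mul_comm]
  ring

lemma abs_meanNoise_le (hN : 2 ≤ N) {e : Fin N → ℝ} (he : ∀ i, e i ∈ Icc (-εmax) εmax) :
    |meanNoise e| ≤ εmax := by
  have hN0 : (0 : ℝ) < N := by
    have : 0 < N := by omega
    exact_mod_cast this
  rw [meanNoise, abs_mul, abs_of_pos (by positivity : (0 : ℝ) < 1 / N), one_div_mul_eq_div,
    div_le_iff₀ hN0]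
  calc |∑ i, e i| ≤ ∑ i, |e i| := Finset.abs_sum_le_sum_abs _ _
    _ ≤ ∑ _i : Fin N, εmax := Finset.sum_le_sum fun i _ => abs_le.2 ⟨(he i).1, (he i).2⟩
    _ = εmax * N := by simp [mul_comm]

lemma ae_abs_meanNoise_le (hf : IsNoiseDensity εmax f) (hN : 2 ≤ N) :
    ∀ᵐ e ∂noiseVec N f, |meanNoise e| ≤ εmax := by
  have := hf.isProbabilityMeasure_noiseLaw
  filter_upwards [ae_noiseVec hf.ae_mem_Icc] with e he using abs_meanNoise_le hN he

lemma integral_meanNoise (hf : IsNoiseDensity εmax f) :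
    ∫ e, meanNoise e ∂noiseVec N f = 0 := by
  have := hf.isProbabilityMeasure_noiseLaw
  have hid : Integrable (fun z : ℝ => z) (noiseLaw f) := by
    refine Integrable.of_bound measurable_id.aestronglyMeasurable εmax ?_
    filter_upwards [hf.ae_mem_Icc] with z hz using abs_le.2 ⟨hz.1, hz.2⟩
  have hi : ∀ i : Fin N, Integrable (fun e : Fin N → ℝ => e i) (noiseVec N f) := fun i =>
    integrable_comp_eval (μ := fun _ : Fin N => noiseLaw f) hid
  simp only [meanNoise]
  rw [integral_const_mul, integral_finsetSum _ fun i _ => hi i]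
  have : ∀ i : Fin N, ∫ e, e i ∂noiseVec N f = 0 := fun i => by
    rw [integral_comp_eval (μ := fun _ : Fin N => noiseLaw f) (f := fun z : ℝ => z)
      measurable_id.aestronglyMeasurable, hf.mean_zero]
  simp [this]

/-- This is nonnegativity of the variance of `|Z|`. -/
lemma integral_abs_le_sqrt {Ω : Type*} [MeasurableSpace Ω] {μ : Measure Ω} [IsProbabilityMeasure μ]
    {Z : Ω → ℝ} (hZ : MemLp Z 2 μ) : ∫ ω, |Z ω| ∂μ ≤ √(∫ ω, Z ω ^ 2 ∂μ) := by
  refine Real.le_sqrt_of_sq_le ?_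
  have h1 := variance_nonneg (fun ω => |Z ω|) μ
  rw [variance_eq_sub (X := fun ω => |Z ω|) hZ.abs] at h1
  simpa using h1

/-- A weighted sum of the average noises of independent periods. -/
lemma integral_sq_sum_meanNoise_le (hf : IsNoiseDensity εmax f) (hN : 2 ≤ N) (c : Fin n → ℝ) :
    MemLp (fun es : Fin n → Fin N → ℝ => ∑ τ, c τ * meanNoise (es τ)) 2
        (Measure.pi fun _ => noiseVec N f) ∧
      ∫ es : Fin n → Fin N → ℝ, (∑ τ, c τ * meanNoise (es τ)) ^ 2
        ∂(Measure.pi fun _ => noiseVec N f) ≤ εmax ^ 2 * ∑ τ, c τ ^ 2 := by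
  have := hf.isProbabilityMeasure_noiseLaw
  have hm : ∀ τ, MemLp (fun e : Fin N → ℝ => c τ * meanNoise e) 2 (noiseVec N f) := by
    intro τ
    refine MemLp.of_bound (measurable_meanNoise.const_mul _).aestronglyMeasurable (|c τ| * εmax) ?_
    filter_upwards [ae_abs_meanNoise_le hf hN] with e he
    rw [Real.norm_eq_abs, abs_mul]
    gcongr
  have hm' : ∀ τ, MemLp (fun es : Fin n → Fin N → ℝ => c τ * meanNoise (es τ)) 2
      (Measure.pi fun _ => noiseVec N f) := fun τ =>
    (hm τ).comp_measurePreserving (measurePreserving_eval (fun _ : Fin n => noiseVec N f) τ)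
  have hmem : MemLp (fun es : Fin n → Fin N → ℝ => ∑ τ, c τ * meanNoise (es τ)) 2
      (Measure.pi fun _ => noiseVec N f) := memLp_finsetSum _ fun τ _ => hm' τ
  refine ⟨hmem, ?_⟩
  have hmean : ∫ es : Fin n → Fin N → ℝ, (∑ τ, c τ * meanNoise (es τ))
      ∂(Measure.pi fun _ => noiseVec N f) = 0 := by
    rw [integral_finsetSum _ fun τ _ => (hm' τ).integrable (by norm_num)]
    refine Finset.sum_eq_zero fun τ _ => ?_
    rw [integral_comp_eval (μ := fun _ : Fin n => noiseVec N f)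
      (f := fun e : Fin N → ℝ => c τ * meanNoise e)
      (measurable_meanNoise.const_mul _).aestronglyMeasurable, integral_const_mul,
      integral_meanNoise hf, mul_zero]
  have hvar := variance_sum_pi (μ := fun _ : Fin n => noiseVec N f)
    (X := fun τ e => c τ * meanNoise e) hm
  have hfun : (∑ τ, fun es : Fin n → Fin N → ℝ => c τ * meanNoise (es τ))
      = fun es => ∑ τ, c τ * meanNoise (es τ) := by
    funext es; simp
  rw [hfun, variance_eq_sub hmem, hmean] at hvar
  -- The crude bound by `εmax ^ 2` is enough; the gain from averaging `N` noises is not exploited.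
  have hle : ∀ τ, Var[fun e : Fin N → ℝ => c τ * meanNoise e; noiseVec N f]
      ≤ εmax ^ 2 * c τ ^ 2 := by
    intro τ
    refine (variance_le_expectation_sq (hm τ).aestronglyMeasurable).trans ?_
    calc ∫ e, ((fun e : Fin N → ℝ => c τ * meanNoise e) ^ 2) e ∂noiseVec N f
        ≤ ∫ _e, εmax ^ 2 * c τ ^ 2 ∂noiseVec N f := by
          refine integral_mono_ae (hm τ).integrable_sq (integrable_const _) ?_
          filter_upwards [ae_abs_meanNoise_le hf hN] with e he
          simp only [Pi.pow_apply, mul_pow]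
          have := sq_le_sq' (by linarith [(abs_le.1 he).1]) (abs_le.1 he).2
          nlinarith [sq_nonneg (c τ)]
      _ = _ := by simp
  calc ∫ es : Fin n → Fin N → ℝ, (∑ τ, c τ * meanNoise (es τ)) ^ 2
        ∂(Measure.pi fun _ => noiseVec N f)
      = ∑ τ, Var[fun e : Fin N → ℝ => c τ * meanNoise e; noiseVec N f] := by
        rw [← hvar]; simp
    _ ≤ ∑ τ, εmax ^ 2 * c τ ^ 2 := Finset.sum_le_sum fun τ _ => hle τ
    _ = εmax ^ 2 * ∑ τ, c τ ^ 2 := by rw [Finset.mul_sum]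

/-- The truncated prediction error for given contexts, averaged over the noises. -/
lemma lintegral_min_predError_le (hf : IsNoiseDensity εmax f) (hε : 0 < εmax) (hN : 2 ≤ N)
    (β : Fin d → ℝ) {L : ℝ} (hL : 0 ≤ L) (xs : Fin n → Fin d → ℝ) (x : Fin d → ℝ) :
    ∫⁻ es : Fin n → Fin N → ℝ,
        ENNReal.ofReal (min 1 (L * |predError β (fun τ => (xs τ, es τ)) x|))
        ∂(Measure.pi fun _ => noiseVec N f)
      ≤ ENNReal.ofReal ((1 + L * εmax) * √(2 * leverage xs x)) := by
  have := hf.isProbabilityMeasure_noiseLaw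
  have hLε : 0 ≤ L * εmax := mul_nonneg hL hε.le
  -- Small leverage: unbiasedness and the variance bound give the term with `L * εmax`. Large
  -- leverage: the truncation at one is below `√(2 * leverage xs x)`, which accounts for the summand
  -- `1`.
  by_cases hq : leverage xs x ≤ 1 / 2
  · obtain ⟨h1, h2⟩ := pinv_gram_of_leverage_le xs x hq
    set c : Fin n → ℝ := fun τ => xs τ ⬝ᵥ (pinv (gram xs) *ᵥ x) with hc
    obtain ⟨hmem, hsq⟩ := integral_sq_sum_meanNoise_le (n := n) hf hN c
    have hZ : ∀ es : Fin n → Fin N → ℝ, predError β (fun τ => (xs τ, es τ)) x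
        = ∑ τ, c τ * meanNoise (es τ) := fun es =>
      predError_eq hN β (fun τ => (xs τ, es τ)) x h1
    have habs : ∫ es : Fin n → Fin N → ℝ, |∑ τ, c τ * meanNoise (es τ)|
        ∂(Measure.pi fun _ => noiseVec N f) ≤ εmax * √(2 * leverage xs x) := by
      refine (integral_abs_le_sqrt hmem).trans ?_
      rw [show εmax * √(2 * leverage xs x) = √(εmax ^ 2 * (2 * leverage xs x)) by
        rw [Real.sqrt_mul (sq_nonneg _), Real.sqrt_sq hε.le]]
      exact Real.sqrt_le_sqrt (hsq.trans (mul_le_mul_of_nonneg_left h2 (sq_nonneg _)))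
    calc ∫⁻ es : Fin n → Fin N → ℝ,
          ENNReal.ofReal (min 1 (L * |predError β (fun τ => (xs τ, es τ)) x|))
          ∂(Measure.pi fun _ => noiseVec N f)
        ≤ ∫⁻ es : Fin n → Fin N → ℝ, ENNReal.ofReal (L * |∑ τ, c τ * meanNoise (es τ)|)
          ∂(Measure.pi fun _ => noiseVec N f) := by
          refine lintegral_mono fun es => ENNReal.ofReal_le_ofReal ?_
          rw [hZ]
          exact min_le_right _ _
      _ = ENNReal.ofReal (∫ es : Fin n → Fin N → ℝ, L * |∑ τ, c τ * meanNoise (es τ)|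
          ∂(Measure.pi fun _ => noiseVec N f)) := by
          rw [ofReal_integral_eq_lintegral_ofReal
            (((hmem.integrable (by norm_num)).abs).const_mul L)
            (Eventually.of_forall fun es => mul_nonneg hL (abs_nonneg _))]
      _ ≤ _ := by
          refine ENNReal.ofReal_le_ofReal ?_
          rw [integral_const_mul]
          have := mul_le_mul_of_nonneg_left habs hL
          linarith [Real.sqrt_nonneg (2 * leverage xs x)]
  · have h1 : 1 ≤ √(2 * leverage xs x) := by
      rw [Real.one_le_sqrt]; linarith [not_le.1 hq]
    calc ∫⁻ es : Fin n → Fin N → ℝ,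
          ENNReal.ofReal (min 1 (L * |predError β (fun τ => (xs τ, es τ)) x|))
          ∂(Measure.pi fun _ => noiseVec N f)
        ≤ ∫⁻ _es : Fin n → Fin N → ℝ, 1 ∂(Measure.pi fun _ => noiseVec N f) := by
          refine lintegral_mono fun es => ?_
          rw [← ENNReal.ofReal_one]
          exact ENNReal.ofReal_le_ofReal (min_le_left _ _)
      _ = 1 := by simp
      _ ≤ _ := by
          rw [← ENNReal.ofReal_one]
          refine ENNReal.ofReal_le_ofReal ?_
          nlinarith

/-- By exchangeability the expected leverage of a fresh context is at most `d / (n + 1)`. -/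
lemma integral_leverage_le (D : Measure (Fin d → ℝ)) [IsProbabilityMeasure D] :
    Integrable (fun p : (Fin d → ℝ) × (Fin n → Fin d → ℝ) => leverage p.2 p.1)
        (D.prod (Measure.pi fun _ => D)) ∧
      ∫ p : (Fin d → ℝ) × (Fin n → Fin d → ℝ), leverage p.2 p.1 ∂(D.prod (Measure.pi fun _ => D))
        ≤ d / (n + 1) := by
  have hint : Integrable (fun p : (Fin d → ℝ) × (Fin n → Fin d → ℝ) => leverage p.2 p.1)
      (D.prod (Measure.pi fun _ => D)) := by
    refine Integrable.of_bound measurable_leverage.aestronglyMeasurable d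
      (Eventually.of_forall fun p => ?_)
    rw [Real.norm_eq_abs, abs_of_nonneg (leverage_nonneg _ _)]
    exact leverage_le _ _
  refine ⟨hint, ?_⟩
  -- Singling out any one of `n + 1` independent contexts gives the same joint law, so the `n + 1`
  -- expected leverages coincide and share the total `d`.
  have hmp : ∀ i : Fin (n + 1), MeasurePreserving
      (fun ys : Fin (n + 1) → Fin d → ℝ => (ys i, fun j => ys (i.succAbove j)))
      (Measure.pi fun _ => D) (D.prod (Measure.pi fun _ => D)) := fun i =>
    measurePreserving_piFinSuccAbove (fun _ : Fin (n + 1) => D) i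
  have hi : ∀ i : Fin (n + 1), Integrable
      (fun ys : Fin (n + 1) → Fin d → ℝ => leverage (fun j => ys (i.succAbove j)) (ys i))
      (Measure.pi fun _ => D) := fun i => (hmp i).integrable_comp_of_integrable hint
  have heq : ∀ i : Fin (n + 1),
      ∫ ys : Fin (n + 1) → Fin d → ℝ, leverage (fun j => ys (i.succAbove j)) (ys i)
        ∂(Measure.pi fun _ => D)
      = ∫ p : (Fin d → ℝ) × (Fin n → Fin d → ℝ), leverage p.2 p.1
        ∂(D.prod (Measure.pi fun _ => D)) := by
    intro i
    rw [← (hmp i).map_eq, integral_map (hmp i).measurable.aemeasurable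
      measurable_leverage.aestronglyMeasurable]
  have hsum : ∑ i : Fin (n + 1),
      ∫ ys : Fin (n + 1) → Fin d → ℝ, leverage (fun j => ys (i.succAbove j)) (ys i)
        ∂(Measure.pi fun _ => D) ≤ d := by
    rw [← integral_finsetSum _ fun i _ => hi i]
    calc _ ≤ ∫ _ys : Fin (n + 1) → Fin d → ℝ, (d : ℝ) ∂(Measure.pi fun _ => D) :=
          integral_mono (integrable_finsetSum _ fun i _ => hi i) (integrable_const _)
            fun ys => sum_leverage_le ys
      _ = d := by simp
  simp only [heq, Finset.sum_const, Finset.card_univ, Fintype.card_fin, nsmul_eq_mul] at hsum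
  rw [le_div_iff₀ (by positivity), mul_comm]
  exact_mod_cast hsum

/-- The expected truncated prediction error at a fresh context. -/
lemma integral_min_predError_le (hf : IsNoiseDensity εmax f) (hε : 0 < εmax) (hN : 2 ≤ N)
    (D : Measure (Fin d → ℝ)) [IsProbabilityMeasure D] (β : Fin d → ℝ) {L : ℝ} (hL : 0 ≤ L) :
    ∫ p, min 1 (L * |predError β p.1 p.2|) ∂(periodLaw N f D n)
      ≤ (1 + L * εmax) * √(2 * d / (n + 1)) := by
  have := hf.isProbabilityMeasure_noiseLaw
  have hLε : 0 ≤ L * εmax := mul_nonneg hL hε.le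
  set G : History d N n × (Fin d → ℝ) → ℝ := fun p => min 1 (L * |predError β p.1 p.2|) with hG
  have mG : Measurable G :=
    measurable_const.min (((measurable_predError β).abs).const_mul L)
  have hG0 : ∀ p, 0 ≤ G p := fun p => le_min zero_le_one (mul_nonneg hL (abs_nonneg _))
  obtain ⟨hlint, hlev⟩ := integral_leverage_le (n := n) D
  have hlp : MemLp (fun p : (Fin d → ℝ) × (Fin n → Fin d → ℝ) => √(2 * leverage p.2 p.1)) 2
      (D.prod (Measure.pi fun _ => D)) := by
    refine MemLp.of_bound (measurable_leverage.const_mul 2).sqrt.aestronglyMeasurable (√(2 * d))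
      (Eventually.of_forall fun p => ?_)
    rw [Real.norm_eq_abs, abs_of_nonneg (Real.sqrt_nonneg _)]
    exact Real.sqrt_le_sqrt (by linarith [leverage_le p.2 p.1])
  have hsqrt : ∫ p : (Fin d → ℝ) × (Fin n → Fin d → ℝ), √(2 * leverage p.2 p.1)
      ∂(D.prod (Measure.pi fun _ => D)) ≤ √(2 * d / (n + 1)) := by
    have h1 := integral_abs_le_sqrt hlp
    simp only [abs_of_nonneg (Real.sqrt_nonneg _)] at h1
    refine h1.trans (Real.sqrt_le_sqrt ?_)
    have h2 : ∀ p : (Fin d → ℝ) × (Fin n → Fin d → ℝ),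
        √(2 * leverage p.2 p.1) ^ 2 = 2 * leverage p.2 p.1 := fun p =>
      Real.sq_sqrt (by linarith [leverage_nonneg p.2 p.1])
    simp only [h2, integral_const_mul]
    rw [mul_div_assoc]
    linarith
  -- Contexts and noises of the past are separated, so that the noises are integrated first with all
  -- contexts fixed.
  have hinner : ∀ x : Fin d → ℝ, ∫⁻ h : History d N n, ENNReal.ofReal (G (h, x))
        ∂(Measure.pi fun _ => D.prod (noiseVec N f))
      ≤ ∫⁻ xs : Fin n → Fin d → ℝ, ENNReal.ofReal ((1 + L * εmax) * √(2 * leverage xs x))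
        ∂(Measure.pi fun _ => D) := by
    intro x
    have mGx : Measurable fun q : (Fin n → Fin d → ℝ) × (Fin n → Fin N → ℝ) =>
        ENNReal.ofReal (G (fun τ => (q.1 τ, q.2 τ), x)) :=
      (mG.comp (by fun_prop)).ennreal_ofReal
    calc ∫⁻ h : History d N n, ENNReal.ofReal (G (h, x))
          ∂(Measure.pi fun _ => D.prod (noiseVec N f))
        = ∫⁻ q : (Fin n → Fin d → ℝ) × (Fin n → Fin N → ℝ),
            ENNReal.ofReal (G (fun τ => (q.1 τ, q.2 τ), x))
            ∂((Measure.pi fun _ => D).prod (Measure.pi fun _ => noiseVec N f)) := by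
          rw [← (measurePreserving_arrowProdEquivProdArrow (Fin d → ℝ) (Fin N → ℝ) (Fin n)
            (fun _ => D) (fun _ => noiseVec N f)).lintegral_comp mGx]
          rfl
      _ = ∫⁻ xs : Fin n → Fin d → ℝ, ∫⁻ es : Fin n → Fin N → ℝ,
            ENNReal.ofReal (G (fun τ => (xs τ, es τ), x))
            ∂(Measure.pi fun _ => noiseVec N f) ∂(Measure.pi fun _ => D) :=
          lintegral_prod _ mGx.aemeasurable
      _ ≤ _ := lintegral_mono fun xs => lintegral_min_predError_le hf hε hN β hL xs x
  rw [integral_eq_lintegral_of_nonneg_ae (Eventually.of_forall hG0) mG.aestronglyMeasurable]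
  refine ENNReal.toReal_le_of_le_ofReal (by positivity) ?_
  have mlev : Measurable fun p : (Fin d → ℝ) × (Fin n → Fin d → ℝ) =>
      ENNReal.ofReal ((1 + L * εmax) * √(2 * leverage p.2 p.1)) :=
    ((measurable_leverage.const_mul 2).sqrt.const_mul _).ennreal_ofReal
  calc ∫⁻ p, ENNReal.ofReal (G p) ∂(periodLaw N f D n)
      = ∫⁻ x, ∫⁻ h : History d N n, ENNReal.ofReal (G (h, x))
          ∂(Measure.pi fun _ => D.prod (noiseVec N f)) ∂D := by
        rw [periodLaw, lintegral_prod_symm' _ mG.ennreal_ofReal]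
    _ ≤ ∫⁻ x, ∫⁻ xs : Fin n → Fin d → ℝ, ENNReal.ofReal ((1 + L * εmax) * √(2 * leverage xs x))
        ∂(Measure.pi fun _ => D) ∂D := lintegral_mono hinner
    _ = ∫⁻ p : (Fin d → ℝ) × (Fin n → Fin d → ℝ),
          ENNReal.ofReal ((1 + L * εmax) * √(2 * leverage p.2 p.1))
          ∂(D.prod (Measure.pi fun _ => D)) := by
        rw [lintegral_prod _ mlev.aemeasurable]
    _ = ENNReal.ofReal (∫ p : (Fin d → ℝ) × (Fin n → Fin d → ℝ),
          (1 + L * εmax) * √(2 * leverage p.2 p.1) ∂(D.prod (Measure.pi fun _ => D))) := by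
        rw [ofReal_integral_eq_lintegral_ofReal ((hlp.integrable (by norm_num)).const_mul _)
          (Eventually.of_forall fun p => by positivity)]
    _ ≤ _ := by
        refine ENNReal.ofReal_le_ofReal ?_
        rw [integral_const_mul]
        gcongr

end PredictionError

end NPAC

namespace NPAC

/-! ### Estimated distribution functions -/

section Estimation

variable {d N n : ℕ} {εmax vmax xmax lam0 : ℝ} {f : ℝ → ℝ} {g : (Fin N → ℝ) → ℝ}

open scoped Classical in
/-- Empirical distribution function of the residuals of a bid statistic. -/
noncomputable def statHat (g : (Fin N → ℝ) → ℝ) (h : History d N n) (z : ℝ) : ℝ :=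
  (1 / (n : ℝ)) * ∑ τ, if g (h τ).2 - betaHat h ⬝ᵥ (h τ).1 ≤ z then 1 else 0

lemma statHat_mono (h : History d N n) : Monotone (statHat g h) := by
  intro a b hab
  refine mul_le_mul_of_nonneg_left (Finset.sum_le_sum fun τ _ => ?_) (by positivity)
  split_ifs with h1 h2
  · exact le_rfl
  · exact absurd (h1.trans hab) h2
  · exact zero_le_one
  · exact le_rfl

lemma statHat_nonneg (h : History d N n) (z : ℝ) : 0 ≤ statHat g h z :=
  mul_nonneg (by positivity) (Finset.sum_nonneg fun τ _ => by split_ifs <;> norm_num)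

lemma statHat_le_one (h : History d N n) (z : ℝ) : statHat g h z ≤ 1 := by
  classical
  have h1 : (∑ τ, if g (h τ).2 - betaHat h ⬝ᵥ (h τ).1 ≤ z then (1 : ℝ) else 0) ≤ n := by
    calc _ ≤ ∑ _τ : Fin n, (1 : ℝ) :=
          Finset.sum_le_sum fun τ _ => by split_ifs <;> norm_num
      _ = n := by simp
  rw [statHat, one_div_mul_eq_div]
  exact div_le_one_of_le₀ h1 (Nat.cast_nonneg n)

lemma abs_statHat_sub_statCdf_le [IsProbabilityMeasure (noiseLaw f)] (h : History d N n)
    (a b : ℝ) : |statHat g h a - statCdf f g b| ≤ 1 := by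
  rw [abs_le]
  constructor <;> linarith [statHat_nonneg (g := g) h a, statHat_le_one (g := g) h a,
    statCdf_nonneg (f := f) (g := g) b, statCdf_le_one (f := f) (g := g) b]

/-- The truncated prediction error. -/
noncomputable def truncError (L : ℝ) (β : Fin d → ℝ) (h : History d N n) (x : Fin d → ℝ) : ℝ :=
  min 1 (L * |predError β h x|)

lemma measurable_truncError (L : ℝ) (β : Fin d → ℝ) :
    Measurable fun p : History d N n × (Fin d → ℝ) => truncError L β p.1 p.2 :=
  measurable_const.min (((measurable_predError β).abs).const_mul L)

lemma truncError_nonneg {L : ℝ} (hL : 0 ≤ L) (β : Fin d → ℝ) (h : History d N n)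
    (x : Fin d → ℝ) : 0 ≤ truncError L β h x :=
  le_min zero_le_one (mul_nonneg hL (abs_nonneg _))

lemma integrable_truncError {L : ℝ} (hL : 0 ≤ L) (β : Fin d → ℝ)
    (μ : Measure (History d N n × (Fin d → ℝ))) [IsFiniteMeasure μ] :
    Integrable (fun p => truncError L β p.1 p.2) μ := by
  refine Integrable.of_bound (measurable_truncError L β).aestronglyMeasurable 1
    (Eventually.of_forall fun p => ?_)
  rw [Real.norm_eq_abs, abs_of_nonneg (truncError_nonneg hL β _ _)]
  exact min_le_left _ _

lemma measureReal_map_halfSpace (hf : IsNoiseDensity εmax f) (hg : IsBidStatistic g)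
    (D : Measure (Fin d → ℝ)) [IsProbabilityMeasure D] (b : Fin d → ℝ) (w : ℝ) :
    ((D.prod (noiseVec N f)).map fun q => (q.1, g q.2)).real (halfSpace b w)
      = ∫ x, statCdf f g (w + b ⬝ᵥ x) ∂D := by
  have := hf.isProbabilityMeasure_noiseLaw
  have hgm := hg.measurable
  have hm : Measurable fun q : (Fin d → ℝ) × (Fin N → ℝ) => (q.1, g q.2) := by fun_prop
  have hS := hm (measurableSet_halfSpace b w)
  have hi : Integrable (((fun q : (Fin d → ℝ) × (Fin N → ℝ) => (q.1, g q.2)) ⁻¹'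
      halfSpace b w).indicator (1 : (Fin d → ℝ) × (Fin N → ℝ) → ℝ)) (D.prod (noiseVec N f)) :=
    (integrable_const (1 : ℝ)).indicator hS
  rw [map_measureReal_apply hm (measurableSet_halfSpace b w), ← integral_indicator_one hS,
    integral_prod _ hi]
  congr 1
  funext x
  have h1 : MeasurableSet {e : Fin N → ℝ | g e ≤ w + b ⬝ᵥ x} := hgm measurableSet_Iic
  rw [statCdf, ← integral_indicator_one h1]
  rfl

/-- The estimated distribution functions are uniformly close to the true ones, up to a uniform
deviation and the prediction errors at the current and at a fresh context. -/
lemma exists_estimation_error (hf : IsNoiseDensity εmax f) (hD : IsContextLaw xmax lam0 D)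
    (hd : 1 ≤ d) (hn : 1 ≤ n) (hg : IsBidStatistic g) (β : Fin d → ℝ) :
    ∃ Δ : History d N n → ℝ, Measurable Δ ∧ (∀ h, 0 ≤ Δ h ∧ Δ h ≤ 1) ∧
      ∫ h, Δ h ∂(Measure.pi fun _ => D.prod (noiseVec N f))
        ≤ √(8 * d * Real.log (2 * n + 1) / n) ∧
      ∀ᵐ h ∂(Measure.pi fun _ => D.prod (noiseVec N f)), ∀ x z,
        |statHat g (truthfulHistory β h) (z - betaHat (truthfulHistory β h) ⬝ᵥ x)
          - statCdf f g (z - β ⬝ᵥ x)|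
        ≤ Δ h + truncError (N * densitySup εmax f) β h x
          + ∫ x', truncError (N * densitySup εmax f) β h x' ∂D := by
  have := hf.isProbabilityMeasure_noiseLaw
  have := hD.isProbabilityMeasure
  have hgm := hg.measurable
  set L := N * densitySup εmax f with hLdef
  have hL : 0 ≤ L := mul_nonneg (Nat.cast_nonneg _) hf.densitySup_nonneg
  set φ : (Fin d → ℝ) × (Fin N → ℝ) → (Fin d → ℝ) × ℝ := fun q => (q.1, g q.2) with hφ
  have mφ : Measurable φ := by fun_prop
  set μ := (D.prod (noiseVec N f)).map φ with hμ
  have : IsProbabilityMeasure μ := Measure.isProbabilityMeasure_map mφ.aemeasurable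
  have hbound : ∀ᵐ p ∂μ, ∀ j, |p.1 j| ≤ xmax := by
    have hS : MeasurableSet {p : (Fin d → ℝ) × ℝ | ∀ j, |p.1 j| ≤ xmax} := by
      have h1 : {p : (Fin d → ℝ) × ℝ | ∀ j, |p.1 j| ≤ xmax} = ⋂ j, {p | |p.1 j| ≤ xmax} := by
        ext p; rw [mem_iInter]; rfl
      rw [h1]
      exact MeasurableSet.iInter fun j => measurableSet_le (by fun_prop) measurable_const
    rw [hμ, ae_map_iff mφ.aemeasurable hS]
    exact Measure.quasiMeasurePreserving_fst.ae hD.bounded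
  obtain ⟨Δ, mΔ, hΔ01, hΔint, hΔ⟩ := exists_uniform_deviation hd hn xmax μ hbound
  have hmp : MeasurePreserving (fun (h : History d N n) τ => φ (h τ))
      (Measure.pi fun _ => D.prod (noiseVec N f)) (Measure.pi fun _ => μ) :=
    measurePreserving_pi (fun _ => D.prod (noiseVec N f)) (fun _ => μ)
      fun _ => mφ.measurePreserving _
  refine ⟨fun h => Δ fun τ => φ (h τ), mΔ.comp hmp.measurable, fun h => hΔ01 _, ?_, ?_⟩
  · rw [← hmp.map_eq, integral_map hmp.measurable.aemeasurable mΔ.aestronglyMeasurable] at hΔint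
    exact hΔint
  filter_upwards [hmp.quasiMeasurePreserving.ae hΔ] with h hh x z
  set b := betaHat (truthfulHistory β h) with hb
  set w := z - b ⬝ᵥ x with hw
  -- A residual is at most `w` exactly when the pair of context and noise statistic lies in the
  -- half-space of slope `b - β`. Since `b` depends on the sample, the deviation bound must hold for
  -- all slopes at once.
  have hhat : statHat g (truthfulHistory β h) w = (1 / (n : ℝ)) * (∑ τ,
      if (φ (h τ)).2 ≤ w + (b - β) ⬝ᵥ (φ (h τ)).1 then 1 else 0) := by
    rw [statHat]
    congr 1
    refine Finset.sum_congr rfl fun τ _ => ?_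
    have h1 : g (valuation β (h τ).1 (h τ).2) = β ⬝ᵥ (h τ).1 + g (h τ).2 := hg.shift _ _
    refine if_congr ?_ rfl rfl
    simp only [truthfulHistory, h1, hφ, sub_dotProduct, ← hb]
    constructor <;> intro h <;> linarith
  have hpop : |μ.real (halfSpace (b - β) w) - statCdf f g (z - β ⬝ᵥ x)|
      ≤ truncError L β h x + ∫ x', truncError L β h x' ∂D := by
    have iF : Integrable (fun x' => statCdf f g (w + (b - β) ⬝ᵥ x')) D := by
      refine Integrable.of_bound ?_ 1 (Eventually.of_forall fun x' => ?_)
      · exact ((statCdf_mono (f := f) (g := g)).measurable.comp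
          ((measurable_dotProduct_const _).const_add w)).aestronglyMeasurable
      · rw [Real.norm_eq_abs, abs_of_nonneg (statCdf_nonneg _)]
        exact statCdf_le_one _
    have iE : Integrable (fun x' => truncError L β h x') D := by
      refine Integrable.of_bound ((measurable_truncError L β).comp
        measurable_prodMk_left).aestronglyMeasurable 1 (Eventually.of_forall fun x' => ?_)
      change |truncError L β h x'| ≤ 1
      rw [abs_of_nonneg (truncError_nonneg hL β _ _)]
      exact min_le_left _ _
    have hpt : ∀ x', |statCdf f g (w + (b - β) ⬝ᵥ x') - statCdf f g (z - β ⬝ᵥ x)|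
        ≤ truncError L β h x + truncError L β h x' := by
      intro x'
      have h1 : |statCdf f g (w + (b - β) ⬝ᵥ x') - statCdf f g (z - β ⬝ᵥ x)| ≤ 1 := by
        rw [abs_le]
        constructor <;> linarith [statCdf_nonneg (f := f) (g := g) (w + (b - β) ⬝ᵥ x'),
          statCdf_le_one (f := f) (g := g) (w + (b - β) ⬝ᵥ x'),
          statCdf_nonneg (f := f) (g := g) (z - β ⬝ᵥ x),
          statCdf_le_one (f := f) (g := g) (z - β ⬝ᵥ x)]
      have h2 := abs_statCdf_sub_le hf hg (w + (b - β) ⬝ᵥ x') (z - β ⬝ᵥ x)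
      -- The choice `w = z - b ⬝ᵥ x` cancels `z` and leaves only prediction errors.
      have h3 : w + (b - β) ⬝ᵥ x' - (z - β ⬝ᵥ x) = predError β h x' - predError β h x := by
        simp only [hw, predError, ← hb, sub_dotProduct]
        ring
      rw [h3] at h2
      have h4 := mul_le_mul_of_nonneg_left (abs_sub (predError β h x') (predError β h x)) hL
      have h5 : 0 ≤ L * |predError β h x| := mul_nonneg hL (abs_nonneg _)
      have h6 : 0 ≤ L * |predError β h x'| := mul_nonneg hL (abs_nonneg _)
      rw [mul_add] at h4
      unfold truncError
      -- If either error is cut off at one, the trivial bound `h1` suffices; otherwise the Lipschitz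
      -- bound applies.
      rcases le_total 1 (L * |predError β h x|) with h7 | h7 <;>
      rcases le_total 1 (L * |predError β h x'|) with h8 | h8 <;>
      simp only [min_eq_left, min_eq_right, h7, h8] <;> linarith
    rw [measureReal_map_halfSpace hf hg D]
    calc |∫ x', statCdf f g (w + (b - β) ⬝ᵥ x') ∂D - statCdf f g (z - β ⬝ᵥ x)|
        = |∫ x', (statCdf f g (w + (b - β) ⬝ᵥ x') - statCdf f g (z - β ⬝ᵥ x)) ∂D| := by
          rw [integral_sub iF (integrable_const _)]; simp
      _ ≤ ∫ x', |statCdf f g (w + (b - β) ⬝ᵥ x') - statCdf f g (z - β ⬝ᵥ x)| ∂D :=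
          abs_integral_le_integral_abs
      _ ≤ ∫ x', (truncError L β h x + truncError L β h x') ∂D :=
          integral_mono (iF.sub (integrable_const _)).abs ((integrable_const _).add iE) hpt
      _ = _ := by rw [integral_add (integrable_const _) iE]; simp
  have hemp := hh (b - β) w
  rw [hhat]
  calc _ ≤ _ := abs_sub_le _ (μ.real (halfSpace (b - β) w)) _
    _ ≤ _ := add_le_add hemp hpop
    _ = _ := by rw [add_assoc]

end Estimation

/-! ### The objective -/

section Objective

variable {d N n : ℕ} {εmax vmax : ℝ} {f : ℝ → ℝ}

lemma intervalIntegrable_comp_sub {G : ℝ → ℝ} (hG : Monotone G) (s a b : ℝ) :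
    IntervalIntegrable (fun z => G (z - s)) volume a b :=
  Monotone.intervalIntegrable fun _ _ h => hG (sub_le_sub_right h s)

/-- Uniform closeness of the distribution functions carries over to the objective. -/
lemma abs_objective_sub_le {G H G' H' : ℝ → ℝ} (hG : Monotone G) (hG' : Monotone G')
    {s s' B B' y : ℝ} (hB : ∀ z, |G' (z - s') - G (z - s)| ≤ B)
    (hB' : ∀ z, |H' (z - s') - H (z - s)| ≤ B') (hy : y ∈ Icc 0 vmax) :
    |objective G H s y - objective G' H' s' y| ≤ vmax * (B + B') := by
  have hB0 : 0 ≤ B := (abs_nonneg _).trans (hB 0)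
  have hB0' : 0 ≤ B' := (abs_nonneg _).trans (hB' 0)
  have h1 : |(∫ z in (0 : ℝ)..y, G (z - s)) - ∫ z in (0 : ℝ)..y, G' (z - s')| ≤ B * vmax := by
    rw [← intervalIntegral.integral_sub (intervalIntegrable_comp_sub hG _ _ _)
      (intervalIntegrable_comp_sub hG' _ _ _), ← Real.norm_eq_abs]
    refine (intervalIntegral.norm_integral_le_of_norm_le_const (C := B) fun z _ => ?_).trans ?_
    · rw [Real.norm_eq_abs, abs_sub_comm]; exact hB z
    · rw [sub_zero, abs_of_nonneg hy.1]
      exact mul_le_mul_of_nonneg_left hy.2 hB0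
  have h2 : |y * H (y - s) - y * H' (y - s')| ≤ vmax * B' := by
    rw [← mul_sub, abs_mul, abs_of_nonneg hy.1, abs_sub_comm]
    exact mul_le_mul hy.2 (hB' y) (abs_nonneg _) (hy.1.trans hy.2)
  rw [objective, objective, sub_sub_sub_comm]
  refine (abs_sub _ _).trans ?_
  linarith

/-- A point that maximizes a perturbed function, as a value or as a limit, nearly maximizes the
original one, if that is continuous. -/
lemma IsArgmaxOrLimit.sub_le {R R' : ℝ → ℝ} {S : Set ℝ} {r B : ℝ} (hr : IsArgmaxOrLimit R' S r)
    (hR : Continuous R) (hB : ∀ y ∈ S, |R y - R' y| ≤ B) {y : ℝ} (hy : y ∈ S) :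
    R y - R r ≤ 2 * B := by
  refine le_of_forall_pos_le_add fun δ hδ => ?_
  have h1 := hr.2 y hy (δ / 2) (by linarith)
  have h2 : ∀ᶠ y' in 𝓝[S] r, R y' < R r + δ / 2 :=
    (hR.continuousAt.continuousWithinAt (s := S)).eventually (gt_mem_nhds (by linarith))
  obtain ⟨y', h3, h4, h5⟩ := (h1.and_eventually (h2.and self_mem_nhdsWithin)).exists
  have h6 := (abs_le.1 (hB y hy)).2
  have h7 := (abs_le.1 (hB y' h5)).1
  linarith

/-- After a shift of variable the integral is a difference of values of one continuous primitive,
which yields continuity in `s` and `y` jointly. -/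
lemma continuous_objective {G H : ℝ → ℝ} (hG : Continuous G) (hH : Continuous H) :
    Continuous fun p : ℝ × ℝ => objective G H p.1 p.2 := by
  have hP : Continuous fun a => ∫ z in (0 : ℝ)..a, G z :=
    intervalIntegral.continuous_primitive (fun a b => hG.intervalIntegrable a b) 0
  have h1 : (fun p : ℝ × ℝ => objective G H p.1 p.2) = fun p =>
      ((∫ z in (0 : ℝ)..(p.2 - p.1), G z) - ∫ z in (0 : ℝ)..(0 - p.1), G z)
        - p.2 * H (p.2 - p.1) := by
    funext p
    rw [objective, intervalIntegral.integral_comp_sub_right,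
      intervalIntegral.integral_interval_sub_left (hG.intervalIntegrable _ _)
        (hG.intervalIntegrable _ _)]
  rw [h1]
  have h2 := hP.comp (continuous_snd.sub continuous_fst : Continuous fun p : ℝ × ℝ => p.2 - p.1)
  have h3 := hP.comp (continuous_const.sub continuous_fst : Continuous fun p : ℝ × ℝ => 0 - p.1)
  exact (h2.sub h3).sub (by fun_prop)

/-- The true objective. -/
noncomputable def trueObjective (N : ℕ) (f : ℝ → ℝ) (s y : ℝ) : ℝ :=
  objective (Fminus N f) (Fplus N f) s y

lemma continuous_trueObjective (hf : IsNoiseDensity εmax f) (hN : 2 ≤ N) :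
    Continuous fun p : ℝ × ℝ => trueObjective N f p.1 p.2 := by
  unfold trueObjective
  rw [Fplus_eq_statCdf hf hN, Fminus_eq_statCdf hf hN]
  exact continuous_objective (continuous_statCdf hf (isBidStatistic_secondHighest hN))
    (continuous_statCdf hf (isBidStatistic_highest hN))

lemma measurable_trueObjective_comp (hf : IsNoiseDensity εmax f) (hN : 2 ≤ N) {Ω : Type*}
    [MeasurableSpace Ω] {s r : Ω → ℝ} (hs : Measurable s) (hr : Measurable r) :
    Measurable fun ω => trueObjective N f (s ω) (r ω) :=
  (continuous_trueObjective hf hN).measurable.comp (hs.prodMk hr)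

lemma statCdf_eq_one {g : (Fin N → ℝ) → ℝ} [IsProbabilityMeasure (noiseLaw f)]
    (hg : IsBidStatistic g) {s y : ℝ} (hs : ∀ᵐ z ∂noiseLaw f, s + z ≤ vmax) (hy : vmax ≤ y) :
    statCdf f g (y - s) = 1 := by
  have h : {e : Fin N → ℝ | g e ≤ y - s} =ᵐ[noiseVec N f] univ := by
    filter_upwards [ae_noiseVec hs] with e he
    refine propext (iff_true_intro ?_)
    obtain ⟨i, hi⟩ := hg.exists_eq e
    change g e ≤ y - s
    linarith [he i]
  rw [statCdf, measureReal_congr h, probReal_univ]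

/-- Reserves above `vmax` are all equally useless. -/
lemma trueObjective_eq_of_le (hf : IsNoiseDensity εmax f) (hN : 2 ≤ N) {s y : ℝ}
    (hs : ∀ᵐ z ∂noiseLaw f, s + z ≤ vmax) (hy : vmax ≤ y) :
    trueObjective N f s y = trueObjective N f s vmax := by
  have := hf.isProbabilityMeasure_noiseLaw
  have h1 := isBidStatistic_highest hN
  have h2 := isBidStatistic_secondHighest hN
  have hint := intervalIntegrable_comp_sub
    (statCdf_mono (f := f) (g := (secondHighest : (Fin N → ℝ) → ℝ))) s
  -- Beyond `vmax` both distribution functions equal one, so the integral gains `y - vmax`, exactly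
  -- what the term `y * F⁺` takes away.
  have htail : ∫ z in vmax..y, statCdf f (secondHighest : (Fin N → ℝ) → ℝ) (z - s) = y - vmax := by
    rw [intervalIntegral.integral_congr (g := fun _ => (1 : ℝ)) fun z hz => ?_]
    · simp
    · rw [uIcc_of_le hy] at hz
      exact statCdf_eq_one h2 hs hz.1
  simp only [trueObjective, objective]
  rw [Fplus_eq_statCdf hf hN, Fminus_eq_statCdf hf hN, statCdf_eq_one h1 hs hy,
    statCdf_eq_one h1 hs le_rfl,
    ← intervalIntegral.integral_add_adjacent_intervals (hint 0 vmax) (hint vmax y), htail]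
  ring

variable {β : Fin d → ℝ} {rstar : (Fin d → ℝ) → ℝ}

/-- The value of the benchmark is measurable, as a supremum over rational reserves, whatever
the choice of maximizers. -/
lemma measurable_benchmark (hf : IsNoiseDensity εmax f) (hN : 2 ≤ N)
    (hr : IsBenchmark N β f rstar) :
    Measurable fun x => trueObjective N f (β ⬝ᵥ x) (rstar x) := by
  have hc := continuous_trueObjective hf hN
  -- The absolute value keeps rational reserves in the benchmark's domain; continuity and density
  -- recover the maximum.
  have heq : (fun x => trueObjective N f (β ⬝ᵥ x) (rstar x))
      = fun x => ⨆ q : ℚ, trueObjective N f (β ⬝ᵥ x) |(q : ℝ)| := by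
    funext x
    have hle : ∀ q : ℚ, trueObjective N f (β ⬝ᵥ x) |(q : ℝ)|
        ≤ trueObjective N f (β ⬝ᵥ x) (rstar x) := fun q => (hr x).2 (abs_nonneg (q : ℝ))
    have hbdd : BddAbove (range fun q : ℚ => trueObjective N f (β ⬝ᵥ x) |(q : ℝ)|) :=
      ⟨_, by rintro _ ⟨q, rfl⟩; exact hle q⟩
    refine le_antisymm (le_of_forall_lt fun c hcx => ?_) (ciSup_le hle)
    have hcont : Continuous fun y : ℝ => trueObjective N f (β ⬝ᵥ x) |y| :=
      hc.comp (continuous_const.prodMk continuous_abs)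
    obtain ⟨q, hq⟩ := Rat.denseRange_cast.exists_mem_open
      (isOpen_Ioi.preimage hcont : IsOpen ((fun y : ℝ => trueObjective N f (β ⬝ᵥ x) |y|) ⁻¹' Ioi c))
      ⟨rstar x, by
        have h0 : 0 ≤ rstar x := (hr x).1
        change c < trueObjective N f (β ⬝ᵥ x) |rstar x|
        rwa [abs_of_nonneg h0]⟩
    exact lt_of_lt_of_le hq (le_ciSup hbdd q)
  rw [heq]
  refine Measurable.iSup fun q => ?_
  exact measurable_trueObjective_comp hf hN (measurable_dotProduct_const β) measurable_const

end Objective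

end NPAC

namespace NPAC

/-! ### Regret -/

section Regret

variable {d N n : ℕ} {εmax vmax xmax lam0 : ℝ} {f : ℝ → ℝ} {β : Fin d → ℝ}
  {D : Measure (Fin d → ℝ)} {rstar : (Fin d → ℝ) → ℝ} {π : Policy d N}

lemma isProbabilityMeasure_periodLaw (hf : IsNoiseDensity εmax f) (hD : IsContextLaw xmax lam0 D) :
    IsProbabilityMeasure (periodLaw N f D n) := by
  have := hf.isProbabilityMeasure_noiseLaw
  have := hD.isProbabilityMeasure
  unfold periodLaw
  infer_instance

lemma revenueLoss_eq (hf : IsNoiseDensity εmax f) (hN : 2 ≤ N) (hπ : IsNPACT vmax π)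
    {p : History d N n × (Fin d → ℝ)}
    (hs : ∀ᵐ z ∂noiseLaw f, 0 ≤ β ⬝ᵥ p.2 + z ∧ β ⬝ᵥ p.2 + z ≤ vmax) :
    revenueLoss β f rstar π n p = trueObjective N f (β ⬝ᵥ p.2) (rstar p.2)
      - trueObjective N f (β ⬝ᵥ p.2) (π n (truthfulHistory β p.1) p.2) := by
  rw [revenueLoss, revenue_eq hf hN (hs.mono fun z hz => hz.1) (hπ.argmax n _ _).1.1,
    benchmarkRevenue, trueObjective, trueObjective]
  ring

/-- The loss in one period is controlled by the errors of the estimated distribution functions. -/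
lemma revenueLoss_le (hf : IsNoiseDensity εmax f) (hN : 2 ≤ N) (hv : 0 < vmax)
    (hr : IsBenchmark N β f rstar) (hπ : IsNPACT vmax π) {p : History d N n × (Fin d → ℝ)}
    (hs : ∀ᵐ z ∂noiseLaw f, 0 ≤ β ⬝ᵥ p.2 + z ∧ β ⬝ᵥ p.2 + z ≤ vmax) {B B' : ℝ}
    (hB : ∀ z, |statHat secondHighest (truthfulHistory β p.1)
        (z - betaHat (truthfulHistory β p.1) ⬝ᵥ p.2)
      - statCdf f (secondHighest : (Fin N → ℝ) → ℝ) (z - β ⬝ᵥ p.2)| ≤ B)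
    (hB' : ∀ z, |statHat highest (truthfulHistory β p.1)
        (z - betaHat (truthfulHistory β p.1) ⬝ᵥ p.2)
      - statCdf f (highest : (Fin N → ℝ) → ℝ) (z - β ⬝ᵥ p.2)| ≤ B') :
    0 ≤ revenueLoss β f rstar π n p ∧ revenueLoss β f rstar π n p ≤ 2 * vmax * (B + B') := by
  have := hf.isProbabilityMeasure_noiseLaw
  set s := β ⬝ᵥ p.2
  set r := π n (truthfulHistory β p.1) p.2
  have harg : IsArgmaxOrLimit (objective (statHat secondHighest (truthfulHistory β p.1))
      (statHat highest (truthfulHistory β p.1)) (betaHat (truthfulHistory β p.1) ⬝ᵥ p.2))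
      (Icc 0 vmax) r := hπ.argmax n (truthfulHistory β p.1) p.2
  rw [revenueLoss_eq hf hN hπ hs]
  refine ⟨sub_nonneg.2 ((hr p.2).2 harg.1.1), ?_⟩
  -- The benchmark ranges over all `y ≥ 0` and the policy only over `[0, vmax]`; capping the
  -- benchmark reserve costs nothing.
  have hcap : trueObjective N f s (rstar p.2) = trueObjective N f s (min (rstar p.2) vmax) := by
    rcases le_total (rstar p.2) vmax with h | h
    · rw [min_eq_left h]
    · rw [min_eq_right h, trueObjective_eq_of_le hf hN (hs.mono fun z hz => hz.2) h]
  have hcont : Continuous fun y => trueObjective N f s y :=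
    (continuous_trueObjective hf hN).comp (continuous_const.prodMk continuous_id)
  have hclose : ∀ y ∈ Icc 0 vmax, |trueObjective N f s y
      - objective (statHat secondHighest (truthfulHistory β p.1))
        (statHat highest (truthfulHistory β p.1)) (betaHat (truthfulHistory β p.1) ⬝ᵥ p.2) y|
      ≤ vmax * (B + B') := by
    intro y hy
    rw [trueObjective, Fplus_eq_statCdf hf hN, Fminus_eq_statCdf hf hN]
    exact abs_objective_sub_le statCdf_mono (statHat_mono _) hB hB' hy
  rw [hcap]
  refine (harg.sub_le hcont hclose ⟨le_min (hr p.2).1 hv.le, min_le_right _ _⟩).trans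
    (le_of_eq ?_)
  ring

lemma ae_valuation_periodLaw (hf : IsNoiseDensity εmax f) (hD : IsContextLaw xmax lam0 D)
    (hV : ValuationsBounded vmax β f D) : ∀ᵐ p ∂periodLaw N f D n,
      ∀ᵐ z ∂noiseLaw f, 0 ≤ β ⬝ᵥ p.2 + z ∧ β ⬝ᵥ p.2 + z ≤ vmax := by
  have := hf.isProbabilityMeasure_noiseLaw
  have := hD.isProbabilityMeasure
  exact Measure.quasiMeasurePreserving_snd.ae hV

/-- Two distribution functions differ by at most one, whatever the estimates. This yields
integrability and covers the first period, when there are no data. -/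
lemma ae_revenueLoss_le (hf : IsNoiseDensity εmax f) (hN : 2 ≤ N) (hv : 0 < vmax)
    (hD : IsContextLaw xmax lam0 D) (hV : ValuationsBounded vmax β f D)
    (hr : IsBenchmark N β f rstar) (hπ : IsNPACT vmax π) : ∀ᵐ p ∂periodLaw N f D n,
      0 ≤ revenueLoss β f rstar π n p ∧ revenueLoss β f rstar π n p ≤ 4 * vmax := by
  have := hf.isProbabilityMeasure_noiseLaw
  filter_upwards [ae_valuation_periodLaw hf hD hV] with p hs
  have h := revenueLoss_le hf hN hv hr hπ hs (fun z => abs_statHat_sub_statCdf_le _ _ _)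
    (fun z => abs_statHat_sub_statCdf_le _ _ _)
  exact ⟨h.1, h.2.trans (by linarith)⟩

/-- The maximizer `rstar` need not be measurable, but the loss agrees almost everywhere with a
difference of objective values, whose benchmark part is measurable by `measurable_benchmark`. -/
lemma integrable_revenueLoss (hf : IsNoiseDensity εmax f) (hN : 2 ≤ N) (hv : 0 < vmax)
    (hD : IsContextLaw xmax lam0 D) (hV : ValuationsBounded vmax β f D)
    (hr : IsBenchmark N β f rstar) (hπ : IsNPACT vmax π) :
    Integrable (revenueLoss β f rstar π n) (periodLaw N f D n) := by
  have := isProbabilityMeasure_periodLaw (N := N) (n := n) hf hD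
  have hm : Measurable fun p : History d N n × (Fin d → ℝ) =>
      trueObjective N f (β ⬝ᵥ p.2) (rstar p.2)
        - trueObjective N f (β ⬝ᵥ p.2) (π n (truthfulHistory β p.1) p.2) := by
    have h1 : Measurable fun p : History d N n × (Fin d → ℝ) => (truthfulHistory β p.1, p.2) :=
      ((measurable_truthfulHistory β).comp measurable_fst).prodMk measurable_snd
    have h2 : Measurable ((fun p : History d N n × (Fin d → ℝ) => π n p.1 p.2) ∘
        fun p : History d N n × (Fin d → ℝ) => (truthfulHistory β p.1, p.2)) := (hπ.measurable n).comp h1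
    have h3 : Measurable fun p : History d N n × (Fin d → ℝ) => β ⬝ᵥ p.2 :=
      (measurable_dotProduct_const β).comp measurable_snd
    have h4 : Measurable ((fun x => trueObjective N f (β ⬝ᵥ x) (rstar x)) ∘
        (Prod.snd : History d N n × (Fin d → ℝ) → Fin d → ℝ)) :=
      (measurable_benchmark hf hN hr).comp measurable_snd
    exact h4.sub (measurable_trueObjective_comp hf hN h3 h2)
  have hae : (fun p : History d N n × (Fin d → ℝ) =>
      trueObjective N f (β ⬝ᵥ p.2) (rstar p.2)
        - trueObjective N f (β ⬝ᵥ p.2) (π n (truthfulHistory β p.1) p.2))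
      =ᵐ[periodLaw N f D n] revenueLoss β f rstar π n := by
    filter_upwards [ae_valuation_periodLaw hf hD hV] with p hs
    exact (revenueLoss_eq hf hN hπ hs).symm
  refine Integrable.of_bound (hm.aestronglyMeasurable.congr hae) (4 * vmax) ?_
  filter_upwards [ae_revenueLoss_le hf hN hv hD hV hr hπ] with p hp
  rw [Real.norm_eq_abs, abs_of_nonneg hp.1]
  exact hp.2

lemma integral_revenueLoss_le (hf : IsNoiseDensity εmax f) (hε : 0 < εmax) (hN : 2 ≤ N)
    (hd : 1 ≤ d) (hn : 1 ≤ n) (hv : 0 < vmax) (hD : IsContextLaw xmax lam0 D)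
    (hV : ValuationsBounded vmax β f D) (hr : IsBenchmark N β f rstar) (hπ : IsNPACT vmax π) :
    ∫ p, revenueLoss β f rstar π n p ∂periodLaw N f D n
      ≤ 2 * vmax * (2 * √(8 * d * Real.log (2 * n + 1) / n)
        + 4 * ((1 + N * densitySup εmax f * εmax) * √(2 * d / (n + 1)))) := by
  have := hf.isProbabilityMeasure_noiseLaw
  have := hD.isProbabilityMeasure
  have := isProbabilityMeasure_periodLaw (N := N) (n := n) hf hD
  set L := N * densitySup εmax f with hLdef
  have hL : 0 ≤ L := mul_nonneg (Nat.cast_nonneg _) hf.densitySup_nonneg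
  obtain ⟨Δ, mΔ, hΔ, hΔi, hΔe⟩ :=
    exists_estimation_error hf hD hd hn (isBidStatistic_secondHighest hN) β
  obtain ⟨Δ', mΔ', hΔ', hΔi', hΔe'⟩ :=
    exists_estimation_error hf hD hd hn (isBidStatistic_highest hN) β
  set P := Measure.pi fun _ : Fin n => D.prod (noiseVec N f) with hP
  have hlaw : periodLaw N f D n = P.prod D := rfl
  set E : History d N n × (Fin d → ℝ) → ℝ := fun p => truncError L β p.1 p.2 with hE
  have iE : Integrable E (P.prod D) := integrable_truncError hL β _
  have iE' : Integrable (fun h => ∫ x, E (h, x) ∂D) P := iE.integral_prod_left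
  have hfst : MeasurePreserving (Prod.fst : History d N n × (Fin d → ℝ) → History d N n)
      (P.prod D) P := measurePreserving_fst
  have iΔ : ∀ {Δ : History d N n → ℝ}, Measurable Δ → (∀ h, 0 ≤ Δ h ∧ Δ h ≤ 1) →
      Integrable Δ P := fun hm hb => by
    refine Integrable.of_bound hm.aestronglyMeasurable 1 (Eventually.of_forall fun h => ?_)
    rw [Real.norm_eq_abs, abs_of_nonneg (hb h).1]
    exact (hb h).2
  have hcomp : ∀ {φ : History d N n → ℝ}, Integrable φ P →
      Integrable (fun p : History d N n × (Fin d → ℝ) => φ p.1) (P.prod D) ∧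
      ∫ p : History d N n × (Fin d → ℝ), φ p.1 ∂(P.prod D) = ∫ h, φ h ∂P := fun {φ} hφ => by
    refine ⟨hfst.integrable_comp_of_integrable hφ, ?_⟩
    have h1 : AEStronglyMeasurable φ ((P.prod D).map Prod.fst) := by
      rw [hfst.map_eq]; exact hφ.aestronglyMeasurable
    rw [← integral_map hfst.measurable.aemeasurable h1, hfst.map_eq]
  -- The current context is independent of the history and has law `D`, so the errors at the current
  -- and at a fresh context have equal expectation. With two order statistics this makes the factor
  -- `4`.
  have hEint : ∫ h, ∫ x, E (h, x) ∂D ∂P = ∫ p, E p ∂(P.prod D) := (integral_prod _ iE).symm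
  have hEle : ∫ p, E p ∂(P.prod D) ≤ (1 + L * εmax) * √(2 * d / (n + 1)) :=
    integral_min_predError_le hf hε hN D β hL
  obtain ⟨iΔ1, eΔ1⟩ := hcomp (iΔ mΔ hΔ)
  obtain ⟨iΔ2, eΔ2⟩ := hcomp (iΔ mΔ' hΔ')
  obtain ⟨iE1, eE1⟩ := hcomp iE'
  have hpt : ∀ᵐ p ∂(P.prod D), revenueLoss β f rstar π n p ≤ 2 * vmax *
      (Δ p.1 + Δ' p.1 + 2 * E p + 2 * ∫ x, E (p.1, x) ∂D) := by
    filter_upwards [ae_valuation_periodLaw hf hD hV, hfst.quasiMeasurePreserving.ae hΔe,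
      hfst.quasiMeasurePreserving.ae hΔe'] with p hs h1 h2
    refine (revenueLoss_le hf hN hv hr hπ hs (h1 p.2) (h2 p.2)).2.trans (le_of_eq ?_)
    simp only [hE]
    ring
  have hint : Integrable (fun p : History d N n × (Fin d → ℝ) =>
      Δ p.1 + Δ' p.1 + 2 * E p + 2 * ∫ x, E (p.1, x) ∂D) (P.prod D) :=
    ((iΔ1.add iΔ2).add (iE.const_mul 2)).add (iE1.const_mul 2)
  rw [hlaw]
  calc ∫ p, revenueLoss β f rstar π n p ∂(P.prod D)
      ≤ ∫ p : History d N n × (Fin d → ℝ), 2 * vmax *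
          (Δ p.1 + Δ' p.1 + 2 * E p + 2 * ∫ x, E (p.1, x) ∂D) ∂(P.prod D) :=
        integral_mono_ae (integrable_revenueLoss hf hN hv hD hV hr hπ) (hint.const_mul _) hpt
    _ = 2 * vmax * (∫ h, Δ h ∂P + ∫ h, Δ' h ∂P + 2 * ∫ p, E p ∂(P.prod D)
          + 2 * ∫ p, E p ∂(P.prod D)) := by
        have i12 : Integrable (fun p : History d N n × (Fin d → ℝ) => Δ p.1 + Δ' p.1)
          (P.prod D) := iΔ1.add iΔ2
        have i123 : Integrable (fun p : History d N n × (Fin d → ℝ) => Δ p.1 + Δ' p.1 + 2 * E p)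
          (P.prod D) := i12.add (iE.const_mul 2)
        rw [integral_const_mul, integral_add i123 (iE1.const_mul 2),
          integral_add i12 (iE.const_mul 2), integral_add iΔ1 iΔ2, integral_const_mul,
          integral_const_mul, eΔ1, eΔ2, eE1, hEint]
    _ ≤ _ := by
        refine mul_le_mul_of_nonneg_left ?_ (by positivity)
        linarith

/-- Each term is at most `2 √(t + 1) - 2 √t`, and these increments telescope. -/
lemma sum_inv_sqrt_le (T : ℕ) : ∑ t ∈ Finset.range T, 1 / √((t : ℝ) + 1) ≤ 2 * √T := by
  induction T with
  | zero => simp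
  | succ T ih =>
    rw [Finset.sum_range_succ]
    push_cast
    have h1 : 0 < √((T : ℝ) + 1) := Real.sqrt_pos.2 (by positivity)
    have h2 : √(T : ℝ) ^ 2 = T := Real.sq_sqrt (by positivity)
    have h3 : √((T : ℝ) + 1) ^ 2 = T + 1 := Real.sq_sqrt (by positivity)
    have h4 : 1 / √((T : ℝ) + 1) ≤ 2 * √((T : ℝ) + 1) - 2 * √(T : ℝ) := by
      rw [div_le_iff₀ h1]
      nlinarith [sq_nonneg (√((T : ℝ) + 1) - √(T : ℝ))]
    linarith

/-- The bound on the loss of a single period, uniform over a horizon `T`. -/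
lemma integral_revenueLoss_le_of_lt (hf : IsNoiseDensity εmax f) (hε : 0 < εmax) (hN : 2 ≤ N)
    (hd : 1 ≤ d) (hv : 0 < vmax) (hD : IsContextLaw xmax lam0 D)
    (hV : ValuationsBounded vmax β f D) (hr : IsBenchmark N β f rstar) (hπ : IsNPACT vmax π)
    {T : ℕ} (hT : 2 ≤ T) (hnT : n < T) :
    ∫ p, revenueLoss β f rstar π n p ∂periodLaw N f D n
      ≤ 32 * vmax * εmax * (N * densitySup εmax f) * √(32 * d * Real.log T)
        * (1 / √((n : ℝ) + 1)) := by
  have := isProbabilityMeasure_periodLaw (N := N) (n := n) hf hD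
  have hd1 : (1 : ℝ) ≤ d := by exact_mod_cast hd
  have hN2 : (2 : ℝ) ≤ N := by exact_mod_cast hN
  have hT2 : (2 : ℝ) ≤ T := by exact_mod_cast hT
  have hc := hf.one_le_densitySup
  set c := densitySup εmax f
  have hc0 : 0 ≤ c := hf.densitySup_nonneg
  set l := Real.log T with hl
  have hl1 : 1 / 2 ≤ l := by
    have h1 := Real.log_two_gt_d9
    have h2 := Real.log_le_log (by norm_num) hT2
    linarith
  -- Since `2 * εmax * c ≥ 1` and `N ≥ 2`. This lets the uniform deviation, which has no factor `N *
  -- c`, be absorbed.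
  have hεL : 1 ≤ εmax * (N * c) := by nlinarith [mul_nonneg hε.le hc0]
  rcases Nat.eq_zero_or_pos n with rfl | hn
  · have h1 : ∫ p, revenueLoss β f rstar π 0 p ∂periodLaw N f D 0 ≤ 4 * vmax := by
      calc _ ≤ ∫ _p, 4 * vmax ∂periodLaw N f D 0 :=
            integral_mono_ae (integrable_revenueLoss hf hN hv hD hV hr hπ) (integrable_const _)
              ((ae_revenueLoss_le hf hN hv hD hV hr hπ).mono fun p hp => hp.2)
        _ = 4 * vmax := by simp
    have h2 : 1 ≤ √(32 * d * l) := by rw [Real.one_le_sqrt]; nlinarith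
    have h3 : 1 ≤ εmax * (N * c) * √(32 * d * l) := one_le_mul_of_one_le_of_one_le hεL h2
    simp only [Nat.cast_zero, zero_add, Real.sqrt_one, div_one, mul_one]
    nlinarith [mul_le_mul_of_nonneg_left h3 hv.le]
  · have hn1 : (1 : ℝ) ≤ n := by exact_mod_cast hn
    have hnT' : (n : ℝ) + 1 ≤ T := by exact_mod_cast hnT
    -- From `n + 1 ≤ T` one gets `2 n + 1 ≤ T ^ 2`.
    have hlog : Real.log (2 * n + 1) ≤ 2 * l := by
      rw [hl, ← Nat.cast_two, ← Real.log_pow]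
      push_cast
      exact Real.log_le_log (by positivity) (by nlinarith)
    have hsqrt : √(32 * d * l / (n + 1)) = √(32 * d * l) * (1 / √((n : ℝ) + 1)) := by
      rw [Real.sqrt_div' _ (by positivity)]; ring
    have h1 : √(8 * d * Real.log (2 * n + 1) / n) ≤ √(32 * d * l / (n + 1)) := by
      refine Real.sqrt_le_sqrt ?_
      rw [div_le_div_iff₀ (by positivity) (by positivity)]
      have h2 : 8 * d * Real.log (2 * n + 1) ≤ 16 * d * l := by nlinarith
      have h3 : 0 ≤ 16 * d * l := by positivity
      calc 8 * d * Real.log (2 * n + 1) * (n + 1) ≤ 16 * d * l * (n + 1) := by gcongr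
        _ ≤ 16 * d * l * (2 * n) := by gcongr; linarith
        _ = 32 * d * l * n := by ring
    have h2 : √(2 * d / (n + 1)) ≤ √(32 * d * l / (n + 1)) := by
      refine Real.sqrt_le_sqrt (div_le_div_of_nonneg_right ?_ (by positivity))
      nlinarith
    refine (integral_revenueLoss_le hf hε hN hd hn hv hD hV hr hπ).trans ?_
    rw [mul_assoc _ √(32 * d * l), ← hsqrt]
    set S := √(32 * d * l / (n + 1))
    have hS : 0 ≤ S := Real.sqrt_nonneg _
    have h3 : (1 + N * c * εmax) * √(2 * d / (n + 1)) ≤ 2 * (εmax * (N * c)) * S := by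
      refine mul_le_mul (by linarith) h2 (Real.sqrt_nonneg _) (by positivity)
    have h4 : S ≤ εmax * (N * c) * S := le_mul_of_one_le_left hS hεL
    calc _ ≤ 2 * vmax * (2 * (εmax * (N * c) * S) + 4 * (2 * (εmax * (N * c)) * S)) := by
          gcongr
          exact h1.trans h4
      _ = 20 * vmax * εmax * (N * c) * S := by ring
      _ ≤ 32 * vmax * εmax * (N * c) * S := by gcongr; norm_num

end Regret

end NPAC

/-! ### Summation over the horizon -/

theorem theorem1 (xmax εmax vmax lam0 : ℝ)
    (hxmax : 0 < xmax) (hεmax : 0 < εmax) (hvmax : 0 < vmax) (hlam0 : 0 < lam0) :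
    ∃ C : ℝ, 0 < C ∧
      ∀ (d N : ℕ), 1 ≤ d → 2 ≤ N →
      ∀ (β : Fin d → ℝ) (f : ℝ → ℝ) (D : MeasureTheory.Measure (Fin d → ℝ)),
        NPAC.IsNoiseDensity εmax f →
        NPAC.IsContextLaw xmax lam0 D →
        NPAC.ValuationsBounded vmax β f D →
      ∀ rstar : (Fin d → ℝ) → ℝ, NPAC.IsBenchmark N β f rstar →
      ∀ π : NPAC.Policy d N, NPAC.IsNPACT vmax π →
        (∀ t : ℕ, MeasureTheory.Integrable (NPAC.revenueLoss β f rstar π t)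
          (NPAC.periodLaw N f D t)) ∧
        ∀ T : ℕ, 2 ≤ T →
          NPAC.regret β f D rstar π T ≤
            C * NPAC.densitySup εmax f * Real.sqrt (d * N ^ 3 * T * Real.log T) := by
  -- The factor is `32` from one period, times `2` from the sum of inverse roots, times `6` from
  -- `√32 ≤ 6`.
  refine ⟨384 * vmax * εmax, by positivity, ?_⟩
  intro d N hd hN β f D hf hD hV rstar hr π hπ
  refine ⟨fun t => NPAC.integrable_revenueLoss hf hN hvmax hD hV hr hπ, fun T hT => ?_⟩
  have hc0 := hf.densitySup_nonneg
  have hN1 : (1 : ℝ) ≤ N := by exact_mod_cast le_trans one_le_two hN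
  have hl : 0 ≤ Real.log T := Real.log_natCast_nonneg T
  set c := NPAC.densitySup εmax f
  set K := 32 * vmax * εmax * (N * c) * √(32 * d * Real.log T) with hK
  have hK0 : 0 ≤ K := by positivity
  calc NPAC.regret β f D rstar π T
      ≤ ∑ t ∈ Finset.range T, K * (1 / √((t : ℝ) + 1)) :=
        Finset.sum_le_sum fun t ht => NPAC.integral_revenueLoss_le_of_lt hf hεmax hN hd hvmax hD hV
          hr hπ hT (Finset.mem_range.1 ht)
    _ ≤ K * (2 * √T) := by
        rw [← Finset.mul_sum]
        exact mul_le_mul_of_nonneg_left (NPAC.sum_inv_sqrt_le T) hK0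
    _ = 64 * vmax * εmax * c * √(32 * (d * N ^ 2 * T * Real.log T)) := by
        rw [show 32 * (d * N ^ 2 * T * Real.log T) = N ^ 2 * (32 * d * Real.log T * T) by ring,
          Real.sqrt_mul (by positivity), Real.sqrt_sq (by positivity),
          Real.sqrt_mul (by positivity), hK]
        ring
    _ ≤ 64 * vmax * εmax * c * √(6 ^ 2 * (d * N ^ 3 * T * Real.log T)) := by
        gcongr
        · norm_num
        · norm_num
    _ = 384 * vmax * εmax * c * √(d * N ^ 3 * T * Real.log T) := by
        rw [Real.sqrt_mul (by positivity), Real.sqrt_sq (by norm_num)]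
        ring
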